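/- Notation. For $g:\mathbb R^3\to\mathbb R$ integrable let $\hat g(\eta)=(2\pi)^{-3/2}\int_{\mathbb R^3}e^{-iv\cdot\eta}g(v)\,dv$, $\langle k\rangle=(1+|k|^2)^{1/2}$, $\langle k,kt\rangle=(1+|k|^2+|kt|^2)^{1/2}$, and $\|f\|_{H^\sigma_M}=\sum_{|\beta|\le M}\|\langle\nabla\rangle^\sigma(v^\beta f)\|_{L^2(\mathbb R^3)}$. The interaction potential $W\in L^1(\mathbb R^3)$ is real and satisfies $|\widehat W(k)|\lesssim\langle k\rangle^{-2}$. For $f^0:\mathbb R^3\to\mathbb R$ put $$K^0(t,k)=-\widehat{f^0}(kt)\,\widehat W(k)\,|k|^2t,\qquad \mathcal L(\xi,k)=\int_0^\infty e^{\bar\xi t}K^0(t,k)\,dt .$$ We say that $f^0$ satisfies condition (L) with constants $C_0,\kappa>0$, $\bar\sigma>3/2$ and an integer $M>3/2$ if $\|f^0\|_{H^{\bar\sigma}_M}\le C_0$ and $|\mathcal L(\xi,k)-1|\ge\kappa$ for all $\xi\in\mathbb C$ with $\operatorname{Re}\xi\le0$ and all $k\in\mathbb R^3$. Proposition (Linear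 $L^2_t$ control). Let $s\ge0$ be an integer, let $\bar\sigma>s+3/2$, and let $f^0$ satisfy (L) with constants $C_0,\kappa,\bar\sigma,M$. Then there is a constant $C_{LD}$, depending only on $C_0,s,\bar\sigma,\kappa$ and (an upper bound of) $\|W\|_{L^1}$, such that the following holds for all $\alpha\in\mathbb R$, all $T^\star>0$ and all $k\in\mathbb R^3$. Let $I=[0,T^\star)$, let $H(t,k)=0$ for $t>T^\star$, and let $\||k|^\alpha\langle k,kt\rangle^sH(t,k)\|_{L^2_t(I)}<\infty$. Then the solution $\phi$ of the Volterra equation $$\phi(t,k)=H(t,k)+\int_0^tK^0(t-\tau,k)\,\phi(\tau,k)\,d\tau\qquad(t>0)$$ satisfies the pointwise-in-$k$ estimate $$\||k|^\alpha\langle k,kt\rangle^s\phi(t,k)\|_{L^2_t(I)}\le C_{LD}\,\||k|^\alpha\langle k,kt\rangle^sH(t,k)\|_{L^2_t(I)} .$$ -/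

import Mathlib

open MeasureTheory
open scoped ENNReal FourierTransform ComplexConjugate

noncomputable section

namespace LandauDamping

/-- Three-dimensional Euclidean space (velocities, positions, and their frequencies). -/
abbrev E3 : Type := EuclideanSpace ℝ (Fin 3)

/-- The Fourier transform `ĝ(η) = (2π)^(-3/2) ∫ e^{-i v·η} g(v) dv` on `ℝ³`, in the unitary
normalization. -/
def fourierHat (g : E3 → ℝ) (η : E3) : ℂ :=
  (((2 * Real.pi) ^ (-(3 / 2) : ℝ) : ℝ) : ℂ) *
    ∫ v : E3, Complex.exp (-(Complex.I * ((inner ℝ v η : ℝ) : ℂ))) * (g v : ℂ)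

open Classical in
/-- The norm `‖h‖_{H^σ} = ‖⟨∇⟩^σ h‖_{L²}` (for `σ ≥ 0`), with value `∞` if `h` is not in `H^σ`.
Here `𝓕` is the Fourier transform on `L²` for Mathlib's character `e^{-2πi v·ξ}`; it is unitary,
and the frequency variable is `η = 2πξ`, so that `⟨∇⟩` has the symbol `⟨2πξ⟩`. -/
def sobolevNorm (σ : ℝ) (h : E3 → ℂ) : ℝ≥0∞ :=
  if hh : MemLp h 2 volume then
    eLpNorm (fun ξ : E3 =>
      (((1 + ‖(2 * Real.pi) • ξ‖ ^ 2) ^ (σ / 2) : ℝ) : ℂ) *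
        (𝓕 (hh.toLp h) : Lp ℂ 2 (volume : Measure E3)) ξ) 2 volume
  else ∞

/-- The weighted Sobolev norm `‖f‖_{H^σ_M} = ∑_{|a| ≤ M} ‖⟨∇⟩^σ (v^a f)‖_{L²}`, the sum being over
the multi-indices `a ∈ ℕ³` with `|a| = n ≤ M`. -/
def weightedSobolevNorm (σ : ℝ) (M : ℕ) (f : E3 → ℝ) : ℝ≥0∞ :=
  ∑ n ∈ Finset.range (M + 1), ∑ a ∈ Finset.piAntidiag (Finset.univ : Finset (Fin 3)) n,
    sobolevNorm σ (fun v : E3 => (((∏ i, v i ^ a i) * f v : ℝ) : ℂ))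

/-- The interaction potential: `W ∈ L¹(ℝ³)` with `|Ŵ(k)| ≲ ⟨k⟩^{-2}`. -/
structure IsPotential (W : E3 → ℝ) : Prop where
  integrable : Integrable W volume
  decay : ∃ c : ℝ, ∀ k : E3, ‖fourierHat W k‖ ≤ c * (1 + ‖k‖ ^ 2)⁻¹

/-- The kernel `K⁰(t,k) = - f̂⁰(kt) Ŵ(k) |k|² t`. -/
def kernel (W f₀ : E3 → ℝ) (t : ℝ) (k : E3) : ℂ :=
  -(fourierHat f₀ (t • k) * fourierHat W k * ((‖k‖ ^ 2 * t : ℝ) : ℂ))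

/-- `𝓛(ξ,k) = ∫₀^∞ e^{ξ̄ t} K⁰(t,k) dt`. -/
def dispersion (W f₀ : E3 → ℝ) (ξ : ℂ) (k : E3) : ℂ :=
  ∫ t in Set.Ioi (0 : ℝ), Complex.exp (conj ξ * (t : ℂ)) * kernel W f₀ t k

/-- The stability condition **(L)** for `f⁰`, with constants `C₀, κ, σ, M`. -/
structure StabilityCondition (W f₀ : E3 → ℝ) (C₀ κ σ : ℝ) (M : ℕ) : Prop where
  C₀_pos : 0 < C₀
  κ_pos : 0 < κ
  σ_gt : 3 / 2 < σ
  M_gt : 3 / 2 < (M : ℝ)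
  norm_le : weightedSobolevNorm σ M f₀ ≤ ENNReal.ofReal C₀
  stable : ∀ ξ : ℂ, ξ.re ≤ 0 → ∀ k : E3, κ ≤ ‖dispersion W f₀ ξ k - 1‖

/-- `φ(·,k)` is a (locally integrable) solution of the Volterra equation
`φ(t,k) = H(t,k) + ∫₀ᵗ K⁰(t-τ,k) φ(τ,k) dτ` on `(0,∞)`, at the frequency `k`. -/
structure IsVolterraSolution (W f₀ : E3 → ℝ) (k : E3) (H φ : ℝ → E3 → ℂ) : Prop where
  locallyIntegrable : ∀ T : ℝ, IntegrableOn (fun t => φ t k) (Set.Ioc 0 T) volume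
  equation : ∀ᵐ t ∂(volume.restrict (Set.Ioi (0 : ℝ))),
    φ t k = H t k + ∫ τ in (0 : ℝ)..t, kernel W f₀ (t - τ) k * φ τ k

/-- The function `t ↦ |k|^α ⟨k,kt⟩^s u(t,k)`, where `⟨k,kt⟩ = (1 + |k|² + |kt|²)^{1/2}`. -/
def weighted (α : ℝ) (s : ℕ) (k : E3) (u : ℝ → E3 → ℂ) (t : ℝ) : ℂ :=
  ((‖k‖ ^ α * Real.sqrt (1 + ‖k‖ ^ 2 + ‖t • k‖ ^ 2) ^ s : ℝ) : ℂ) * u t k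

end LandauDamping

end

/-! Fix `k`. The equation is a convolution equation `φ = H + K * φ` on the half-line, and (L) is a
Paley–Wiener condition: the Fourier transform of `e^{-at} K(t)` at `ξ` is `𝓛(-a + 2πiξ, k)`, so all
symbols `1 - 𝓕 (damp a K)` with `a ≥ 0` are bounded below by `κ` (`le_norm_one_sub_fourier_damp`).

By Plancherel, `1 - K_a *` with `K_a = damp a K` is bounded below by `κ` on `L²(ℝ)`, uniformly in
`a`. On the subspace of causal functions it is invertible for large `a`, where `‖K_a‖_{L¹} < 1`. It
is norm-continuous in `a`, so the uniform lower bound carries invertibility down to `a = 0`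
(`isUnit_oneSubConv`). The causal `L²` solution obtained this way has norm at most `κ⁻¹ ‖H‖`.
Uniqueness among locally integrable solutions (`ae_eq_zero_of_volterra`) identifies it with `φ`, so
`φ ∈ L²` need not be known beforehand.

For the weight, write `⟨k,kt⟩ = ⟨k⟩ (1 + (μt)²)^{1/2}` with `μ = |k|/⟨k⟩`, which is comparable to
`⟨k⟩ (1 + μt)`. Since `t = (t-τ) + τ`, the function `μtφ` solves the same equation with source `μtH
+ (μtK) * φ`, and induction on the power applies (`volterra_timeWeight`). The constant involves only
`κ` and a bound on `∫ (1 + μt)^s |K|`.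

This moment is bounded uniformly in `k`: as `μ ≤ |k|`, scaling time by `|k|` reduces it to a trace
estimate for `(1 + t)^s t |f̂⁰(tω)|` along unit rays (`lintegral_fourierHat_ray_le`). There `f̂⁰` is
written as the integral over `r` of `e^{-r}` times the heat evolution of the transform of `(1 +
|v|²) f⁰`. Schur's test on space × ray gives a factor `r^{-1/2}`, integrable at `0`, and `σ > s +
3/2` makes `(1 + t)^{s+1-σ}` square integrable on the ray. -/

namespace LandauDamping

/-! ### Compatibility of the `L²` and `L¹` Fourier transforms. -/

section Fourier

variable {V : Type*} [NormedAddCommGroup V] [InnerProductSpace ℝ V] [FiniteDimensional ℝ V]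
  [MeasurableSpace V] [BorelSpace V]

/-- The Fourier transform on `L²` agrees with the Fourier integral on `L¹ ∩ L²`. -/
theorem fourier_toLp_ae_eq {f : V → ℂ} (hf : Integrable f) (hf2 : MemLp f 2) :
    (𝓕 (hf2.toLp f) : Lp ℂ 2 (volume : Measure V)) =ᵐ[volume] 𝓕 f := by
  have hcont : Continuous (𝓕 f) :=
    VectorFourier.fourierIntegral_continuous Real.continuous_fourierChar
      (by exact continuous_inner) hf
  refine ae_eq_of_integral_contDiff_smul_eq
    ((Lp.memLp _).locallyIntegrable (by norm_num)) hcont.locallyIntegrable ?_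
  intro g hg hgc
  have hgc' : HasCompactSupport (fun x => ((g x : ℝ) : ℂ)) :=
    hgc.comp_left (g := fun x : ℝ => (x : ℂ)) (by simp)
  have hg' : ContDiff ℝ (⊤ : ℕ∞) (fun x => ((g x : ℝ) : ℂ)) :=
    Complex.ofRealCLM.contDiff.comp hg
  set ψ : SchwartzMap V ℂ := hgc'.toSchwartzMap hg' with hψ
  have hψa : ∀ x, ψ x = (g x : ℂ) := fun x => rfl
  -- Both sides are compared as distributions: the transform is moved onto the test function, where
  -- the `L²` class and `f` give the same integral.
  have h1 := congrArg (fun T => T ψ) (Lp.fourier_toTemperedDistribution_eq (hf2.toLp f))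
  simp only [TemperedDistribution.fourier_apply, Lp.toTemperedDistribution_apply] at h1
  have h2 : ∫ x, 𝓕 ψ x • (hf2.toLp f) x = ∫ x, 𝓕 ψ x • f x := by
    refine integral_congr_ae ?_
    filter_upwards [hf2.coeFn_toLp] with x hx
    rw [hx]
  have h3 : ∫ x, 𝓕 ψ x • f x = ∫ x, ψ x • 𝓕 f x := by
    have := VectorFourier.integral_fourierIntegral_smul_eq_flip (L := innerₗ V) (μ := volume)
      (ν := volume) Real.continuous_fourierChar (by exact continuous_inner) ψ.integrable hf
    rw [flip_innerₗ] at this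
    rw [SchwartzMap.fourier_coe]
    exact this
  rw [h2, h3] at h1
  simpa [hψa] using h1.symm

end Fourier

/-! ### Convolution with an `L¹` kernel on `L²(ℝ)`. -/

open scoped Convolution NNReal
open Filter Topology

/-- The Cauchy–Schwarz inequality for the measure `w μ`. -/
theorem sq_lintegral_mul_mul_le {α : Type*} [MeasurableSpace α] {μ : Measure α} {w f g : α → ℝ≥0∞}
    (hw : AEMeasurable w μ) (hf : AEMeasurable f μ) (hg : AEMeasurable g μ) :
    (∫⁻ x, w x * (f x * g x) ∂μ) ^ 2 ≤ (∫⁻ x, w x * f x ^ 2 ∂μ) * ∫⁻ x, w x * g x ^ 2 ∂μ := by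
  have h := ENNReal.lintegral_mul_le_Lp_mul_Lq μ Real.HolderConjugate.two_two
    (f := fun x => w x ^ (1 / 2 : ℝ) * f x) (g := fun x => w x ^ (1 / 2 : ℝ) * g x)
    ((hw.pow_const _).mul hf) ((hw.pow_const _).mul hg)
  have e0 : ∀ x, w x ^ (1 / 2 : ℝ) * f x * (w x ^ (1 / 2 : ℝ) * g x) = w x * (f x * g x) :=
    fun x => by
      rw [mul_mul_mul_comm, ← ENNReal.rpow_add_of_nonneg _ _ (by norm_num) (by norm_num)]; norm_num
  have e2 : ∀ (u : α → ℝ≥0∞) x, (w x ^ (1 / 2 : ℝ) * u x) ^ (2 : ℝ) = w x * u x ^ 2 := fun u x => by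
    rw [ENNReal.mul_rpow_of_nonneg _ _ (by norm_num), ← ENNReal.rpow_mul, ENNReal.rpow_two]
    norm_num
  simp only [Pi.mul_apply, e0, e2] at h
  calc (∫⁻ x, w x * (f x * g x) ∂μ) ^ 2
      ≤ ((∫⁻ x, w x * f x ^ 2 ∂μ) ^ (1 / 2 : ℝ) * (∫⁻ x, w x * g x ^ 2 ∂μ) ^ (1 / 2 : ℝ)) ^ 2 := by
        gcongr
    _ = _ := by
      rw [mul_pow]
      simp only [← ENNReal.rpow_two, ← ENNReal.rpow_mul]; norm_num

/-- Young's inequality `L¹ * L² ⊆ L²` for nonnegative functions. -/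
theorem lintegral_sq_lconvolution_le {f g : ℝ → ℝ≥0∞} (hf : AEMeasurable f) (hg : AEMeasurable g) :
    ∫⁻ x, (∫⁻ y, f y * g (x - y)) ^ 2 ≤ (∫⁻ y, f y) ^ 2 * ∫⁻ y, g y ^ 2 := by
  have hgm : ∀ x, AEMeasurable (fun y => g (x - y)) := fun x =>
    hg.comp_quasiMeasurePreserving (quasiMeasurePreserving_sub_left_of_right_invariant volume x)
  have hm : AEMeasurable (fun p : ℝ × ℝ => f p.2 * g (p.1 - p.2) ^ 2) (volume.prod volume) :=
    (hf.comp_snd).mul ((hg.comp_quasiMeasurePreserving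
      (quasiMeasurePreserving_sub_of_right_invariant volume volume)).pow_const 2)
  calc ∫⁻ x, (∫⁻ y, f y * g (x - y)) ^ 2
      ≤ ∫⁻ x, (∫⁻ y, f y) * ∫⁻ y, f y * g (x - y) ^ 2 :=
        lintegral_mono fun x => by
          -- Cauchy–Schwarz for the measure `f(y) dy`, with the constant function `1` as one factor.
          simpa using sq_lintegral_mul_mul_le hf (aemeasurable_const (b := 1)) (hgm x)
    _ ≤ (∫⁻ y, f y) * ∫⁻ x, ∫⁻ y, f y * g (x - y) ^ 2 := by
        rw [lintegral_const_mul'' _ hm.lintegral_prod_right']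
    _ = (∫⁻ y, f y) * ∫⁻ y, ∫⁻ x, f y * g (x - y) ^ 2 := by
        rw [lintegral_lintegral_swap hm]
    _ = (∫⁻ y, f y) * ∫⁻ y, f y * ∫⁻ x, g x ^ 2 := by
        congr 1
        refine lintegral_congr fun y => ?_
        have hy : AEMeasurable (fun x => g (x - y)) := hg.comp_quasiMeasurePreserving
          (measurePreserving_sub_right volume y).quasiMeasurePreserving
        rw [lintegral_const_mul'' _ (hy.pow_const 2), lintegral_sub_right_eq_self (fun x => g x ^ 2)]
    _ = _ := by rw [lintegral_mul_const'' _ hf, sq, mul_assoc]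

theorem eLpNorm_two_sq {α E : Type*} [MeasurableSpace α] {μ : Measure α} [NormedAddCommGroup E]
    (f : α → E) : eLpNorm f 2 μ ^ 2 = ∫⁻ x, ‖f x‖ₑ ^ 2 ∂μ := by
  rw [eLpNorm_eq_lintegral_rpow_enorm_toReal (by norm_num) (by norm_num), ← ENNReal.rpow_two,
    ← ENNReal.rpow_mul]
  simp

theorem eLpNorm_two_le_of_lintegral_le {α E : Type*} [MeasurableSpace α] {μ : Measure α}
    [NormedAddCommGroup E] {f : α → E} {c : ℝ≥0∞} (h : ∫⁻ x, ‖f x‖ₑ ^ 2 ∂μ ≤ c ^ 2) :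
    eLpNorm f 2 μ ≤ c := by
  rw [← eLpNorm_two_sq] at h
  exact (ENNReal.pow_le_pow_left_iff two_ne_zero).1 h

variable {K u : ℝ → ℂ}

theorem aestronglyMeasurable_convolution (hK : AEStronglyMeasurable K)
    (hu : AEStronglyMeasurable u) :
    AEStronglyMeasurable (K ⋆[ContinuousLinearMap.mul ℂ ℂ] u) :=
  (hK.convolution_integrand (ContinuousLinearMap.mul ℂ ℂ) hu).integral_prod_right'

theorem enorm_convolution_le (K u : ℝ → ℂ) (x : ℝ) :
    ‖(K ⋆[ContinuousLinearMap.mul ℂ ℂ] u) x‖ₑ ≤ ∫⁻ y, ‖K y‖ₑ * ‖u (x - y)‖ₑ := by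
  refine (enorm_integral_le_lintegral_enorm _).trans (lintegral_mono fun y => ?_)
  simp [enorm_mul]

theorem eLpNorm_convolution_le (hK : AEStronglyMeasurable K) (hu : AEStronglyMeasurable u) :
    eLpNorm (K ⋆[ContinuousLinearMap.mul ℂ ℂ] u) 2 volume
      ≤ (∫⁻ y, ‖K y‖ₑ) * eLpNorm u 2 volume := by
  refine eLpNorm_two_le_of_lintegral_le ?_
  rw [mul_pow, eLpNorm_two_sq]
  refine (lintegral_mono fun x => ?_).trans (lintegral_sq_lconvolution_le hK.enorm hu.enorm)
  gcongr
  exact enorm_convolution_le K u x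

theorem memLp_convolution (hK : Integrable K) (hu : MemLp u 2) :
    MemLp (K ⋆[ContinuousLinearMap.mul ℂ ℂ] u) 2 :=
  ⟨aestronglyMeasurable_convolution hK.1 hu.1,
    (eLpNorm_convolution_le hK.1 hu.1).trans_lt (ENNReal.mul_lt_top hK.2 hu.2)⟩

/-- The square of the convolution of absolute values has finite integral, hence is finite almost
everywhere. Additivity of the convolution needs this, since a divergent integral has the value `0`.
-/
theorem ae_convolutionExistsAt (hK : Integrable K) (hu : MemLp u 2) :
    ∀ᵐ x, ConvolutionExistsAt K u x (ContinuousLinearMap.mul ℂ ℂ) := by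
  have h1 : ∫⁻ x, (∫⁻ y, ‖K y‖ₑ * ‖u (x - y)‖ₑ) ^ 2 ≠ ∞ := by
    refine ((lintegral_sq_lconvolution_le hK.1.enorm hu.1.enorm).trans_lt ?_).ne
    rw [← eLpNorm_two_sq]
    exact ENNReal.mul_lt_top (ENNReal.pow_lt_top hK.2) (ENNReal.pow_lt_top hu.2)
  have hm : AEMeasurable (fun p : ℝ × ℝ => ‖K p.2‖ₑ * ‖u (p.1 - p.2)‖ₑ) (volume.prod volume) :=
    (hK.1.enorm.comp_snd).mul (hu.1.enorm.comp_quasiMeasurePreserving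
      (quasiMeasurePreserving_sub_of_right_invariant volume volume))
  filter_upwards [ae_lt_top' (hm.lintegral_prod_right'.pow_const 2) h1] with x hx
  refine ⟨hK.1.mul (hu.1.comp_quasiMeasurePreserving
    (quasiMeasurePreserving_sub_left_of_right_invariant volume x)), ?_⟩
  rw [ENNReal.pow_lt_top_iff] at hx
  simpa [HasFiniteIntegral, enorm_mul] using hx

/-- Convolution with an integrable function, as an operator on `L²(ℝ)`. -/
noncomputable def convL2 (K : ℝ → ℂ) (hK : Integrable K) :
    Lp ℂ 2 (volume : Measure ℝ) →L[ℂ] Lp ℂ 2 (volume : Measure ℝ) :=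
  LinearMap.mkContinuous
    { toFun := fun u => (memLp_convolution hK (Lp.memLp u)).toLp
      map_add' := fun u v => by
        refine Lp.ext ?_
        filter_upwards [MemLp.coeFn_toLp (memLp_convolution hK (Lp.memLp (u + v))),
          Lp.coeFn_add (memLp_convolution hK (Lp.memLp u)).toLp
            (memLp_convolution hK (Lp.memLp v)).toLp,
          MemLp.coeFn_toLp (memLp_convolution hK (Lp.memLp u)),
          MemLp.coeFn_toLp (memLp_convolution hK (Lp.memLp v)),
          ae_convolutionExistsAt hK (Lp.memLp u), ae_convolutionExistsAt hK (Lp.memLp v)]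
          with x h1 h2 h3 h4 h5 h6
        rw [h1, h2, Pi.add_apply, h3, h4, ← h5.distrib_add h6]
        exact congrFun (convolution_congr _ Filter.EventuallyEq.rfl (Lp.coeFn_add u v)) x
      map_smul' := fun c u => by
        refine Lp.ext ?_
        filter_upwards [MemLp.coeFn_toLp (memLp_convolution hK (Lp.memLp (c • u))),
          Lp.coeFn_smul c (memLp_convolution hK (Lp.memLp u)).toLp,
          MemLp.coeFn_toLp (memLp_convolution hK (Lp.memLp u))] with x h1 h2 h3
        rw [h1, RingHom.id_apply, h2, Pi.smul_apply, h3,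
          convolution_congr _ Filter.EventuallyEq.rfl (Lp.coeFn_smul c u), convolution_smul]
        rfl }
    (∫ y, ‖K y‖) (fun u => by
      simp only [LinearMap.coe_mk, AddHom.coe_mk, Lp.norm_toLp]
      rw [Lp.norm_def, integral_norm_eq_lintegral_enorm hK.1, ← ENNReal.toReal_mul]
      exact ENNReal.toReal_mono (ENNReal.mul_ne_top hK.2.ne (Lp.eLpNorm_ne_top u))
        (eLpNorm_convolution_le hK.1 (Lp.memLp u).1))

theorem convL2_ae_eq (hK : Integrable K) (u : Lp ℂ 2 (volume : Measure ℝ)) :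
    convL2 K hK u =ᵐ[volume] K ⋆[ContinuousLinearMap.mul ℂ ℂ] u :=
  MemLp.coeFn_toLp (memLp_convolution hK (Lp.memLp u))

theorem norm_convL2_le (hK : Integrable K) : ‖convL2 K hK‖ ≤ ∫ y, ‖K y‖ :=
  LinearMap.mkContinuous_norm_le _ (integral_nonneg fun _ => norm_nonneg _) _

theorem convL2_sub {K' : ℝ → ℂ} (hK : Integrable K) (hK' : Integrable K') :
    convL2 K hK - convL2 K' hK' = convL2 (K - K') (hK.sub hK') := by
  ext1 u
  refine Lp.ext ?_
  filter_upwards [Lp.coeFn_sub (convL2 K hK u) (convL2 K' hK' u), convL2_ae_eq hK u,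
    convL2_ae_eq hK' u, convL2_ae_eq (hK.sub hK') u, ae_convolutionExistsAt hK (Lp.memLp u),
    ae_convolutionExistsAt hK' (Lp.memLp u)] with x h1 h2 h3 h4 h5 h6
  rw [sub_apply, h1, Pi.sub_apply, h2, h3, h4, convolution_def,
    convolution_def, convolution_def, ← integral_sub h5 h6]
  simp

/-- Plancherel: if the symbol `1 - K̂` is bounded below, so is the operator `1 - K *`. -/
theorem le_norm_sub_convL2 (hK : Integrable K) {κ : ℝ} (h : ∀ ξ : ℝ, κ ≤ ‖1 - 𝓕 K ξ‖)
    (u : Lp ℂ 2 (volume : Measure ℝ)) : κ * ‖u‖ ≤ ‖u - convL2 K hK u‖ := by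
  rcases le_or_gt κ 0 with hκ | hκ
  · exact (mul_nonpos_of_nonpos_of_nonneg hκ (norm_nonneg _)).trans (norm_nonneg _)
  -- Both sides are continuous in `u`, so Schwartz functions suffice. For these `K * ψ` lies in `L¹
  -- ∩ L²` and the convolution theorem holds pointwise.
  refine DenseRange.induction_on (p := fun u => κ * ‖u‖ ≤ ‖u - convL2 K hK u‖)
    (SchwartzMap.denseRange_toLpCLM (p := 2) ENNReal.ofNat_ne_top) u
    (isClosed_le (by fun_prop) (by fun_prop)) fun ψ => ?_
  have hψ := ψ.integrable (μ := volume)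
  have hψ2 := ψ.memLp 2 (μ := volume)
  have e1 : SchwartzMap.toLpCLM ℝ ℂ 2 volume ψ = hψ2.toLp ψ := rfl
  have hc1 : Integrable (K ⋆[ContinuousLinearMap.mul ℂ ℂ] ψ) :=
    hK.integrable_convolution _ hψ
  have hc2 := memLp_convolution hK hψ2
  have e2 : convL2 K hK (hψ2.toLp ψ) = hc2.toLp := by
    refine Lp.ext ((convL2_ae_eq hK _).trans ?_)
    rw [convolution_congr _ Filter.EventuallyEq.rfl hψ2.coeFn_toLp]
    exact hc2.coeFn_toLp.symm
  rw [e1, e2, ← Lp.norm_fourier_eq (hψ2.toLp ψ), ← Lp.norm_fourier_eq (hψ2.toLp ψ - _),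
    ← Real.norm_of_nonneg hκ.le, ← Complex.norm_real, ← norm_smul]
  refine Lp.norm_le_norm_of_ae_le ?_
  rw [show (𝓕 (hψ2.toLp ψ - hc2.toLp) : Lp ℂ 2 (volume : Measure ℝ))
    = 𝓕 (hψ2.toLp ψ) - 𝓕 hc2.toLp from (Lp.fourierTransformₗᵢ ℝ ℂ).map_sub _ _]
  filter_upwards [fourier_toLp_ae_eq hψ hψ2, fourier_toLp_ae_eq hc1 hc2,
    Lp.coeFn_smul (κ : ℂ) (𝓕 (hψ2.toLp ψ) : Lp ℂ 2 (volume : Measure ℝ)),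
    Lp.coeFn_sub (𝓕 (hψ2.toLp ψ) : Lp ℂ 2 (volume : Measure ℝ)) (𝓕 (hc2.toLp))] with ξ h1 h2 h3 h4
  rw [h3, h4, Pi.smul_apply, Pi.sub_apply, h1, h2, Real.fourier_mul_convolution_eq hK hψ, norm_smul,
    Complex.norm_real, Real.norm_of_nonneg hκ.le]
  calc κ * ‖𝓕 (⇑ψ) ξ‖ ≤ ‖1 - 𝓕 K ξ‖ * ‖𝓕 (⇑ψ) ξ‖ := by gcongr; exact h ξ
    _ = _ := by rw [← norm_mul]; congr 1; ring

/-! ### Invertibility along a path of operators. -/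

section ContinuityMethod

variable {Y : Type*} [NormedAddCommGroup Y] [NormedSpace ℂ Y] [CompleteSpace Y]

/-- The lower bound gives `‖A⁻¹‖ ≤ κ⁻¹`, so `B = A (1 - A⁻¹ (A - B))` is a product with a Neumann
series. The admissible radius `κ` depends on `A` only through the lower bound. -/
theorem isUnit_of_norm_sub_lt {A B : Y →L[ℂ] Y} {κ : ℝ} (hκ : 0 < κ) (hA : IsUnit A)
    (hb : ∀ u, κ * ‖u‖ ≤ ‖A u‖) (h : ‖B - A‖ < κ) : IsUnit B := by
  obtain ⟨x, rfl⟩ := hA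
  have hx : ‖(↑x⁻¹ : Y →L[ℂ] Y)‖ ≤ κ⁻¹ := by
    refine ContinuousLinearMap.opNorm_le_bound _ (by positivity) fun u => ?_
    have h1 := hb ((↑x⁻¹ : Y →L[ℂ] Y) u)
    have h2 : (x : Y →L[ℂ] Y) ((↑x⁻¹ : Y →L[ℂ] Y) u) = u := by
      rw [← mul_apply_eq_comp, Units.mul_inv, one_apply_eq_self]
    rw [h2] at h1
    rwa [inv_mul_eq_div, le_div_iff₀' hκ]
  have ht : ‖(↑x⁻¹ : Y →L[ℂ] Y) * (x - B)‖ < 1 := by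
    calc ‖(↑x⁻¹ : Y →L[ℂ] Y) * (x - B)‖ ≤ ‖(↑x⁻¹ : Y →L[ℂ] Y)‖ * ‖(x : Y →L[ℂ] Y) - B‖ :=
          norm_mul_le _ _
      _ ≤ κ⁻¹ * ‖B - x‖ := by rw [norm_sub_rev]; gcongr
      _ < κ⁻¹ * κ := by gcongr
      _ = 1 := inv_mul_cancel₀ hκ.ne'
  have : B = x * (Units.oneSub _ ht : (Y →L[ℂ] Y)ˣ) := by
    rw [Units.val_oneSub, mul_sub, ← mul_assoc, Units.mul_inv]
    simp
  rw [this]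
  exact x.isUnit.mul (Units.isUnit _)

/-- The method of continuity. -/
theorem isUnit_of_continuous {ι : Type*} [TopologicalSpace ι] [PreconnectedSpace ι]
    {A : ι → Y →L[ℂ] Y} (hA : Continuous A) {κ : ℝ} (hκ : 0 < κ)
    (hb : ∀ i u, κ * ‖u‖ ≤ ‖A i u‖) {i₀ : ι} (h₀ : IsUnit (A i₀)) (i : ι) : IsUnit (A i) := by
  have near : ∀ i, ∀ᶠ j in 𝓝 i, ‖A j - A i‖ < κ := fun i => by
    have := (hA.tendsto i).eventually (Metric.ball_mem_nhds (A i) hκ)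
    simpa [dist_eq_norm] using this
  -- Since the radius `κ` is the same at every index, an invertible operator near `A i` forces `A i`
  -- to be invertible: this gives closedness by the same lemma as openness.
  have hclopen : IsClopen {i | IsUnit (A i)} := by
    constructor
    · rw [← isOpen_compl_iff, isOpen_iff_mem_nhds]
      intro i hi
      filter_upwards [near i] with j hj hju
      exact hi (isUnit_of_norm_sub_lt hκ hju (hb j) (by rwa [norm_sub_rev]))
    · rw [isOpen_iff_mem_nhds]
      intro i hi
      filter_upwards [near i] with j hj
      exact isUnit_of_norm_sub_lt hκ hi (hb i) hj
  have := hclopen.eq_univ ⟨i₀, h₀⟩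
  exact this.ge (Set.mem_univ i)

end ContinuityMethod

/-! ### Exponentially damped kernels. -/

section Damp

/-- The exponentially damped kernel `e^{-at} K(t)`. -/
noncomputable def damp (a : ℝ≥0) (K : ℝ → ℂ) (t : ℝ) : ℂ := (Real.exp (-(a * t)) : ℂ) * K t

variable {K : ℝ → ℂ}

theorem damp_zero (K : ℝ → ℂ) : damp 0 K = K := by
  ext t; simp [damp]

theorem damp_of_nonpos (hK0 : ∀ t ≤ 0, K t = 0) (a : ℝ≥0) {t : ℝ} (ht : t ≤ 0) :
    damp a K t = 0 := by simp [damp, hK0 t ht]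

theorem norm_damp (a : ℝ≥0) (K : ℝ → ℂ) (t : ℝ) :
    ‖damp a K t‖ = Real.exp (-(a * t)) * ‖K t‖ := by
  rw [damp, norm_mul, Complex.norm_real, Real.norm_of_nonneg (Real.exp_pos _).le]

theorem norm_damp_le (hK0 : ∀ t ≤ 0, K t = 0) (a : ℝ≥0) (t : ℝ) : ‖damp a K t‖ ≤ ‖K t‖ := by
  rcases le_or_gt t 0 with ht | ht
  · simp [damp, hK0 t ht]
  · rw [norm_damp]
    refine mul_le_of_le_one_left (norm_nonneg _) (Real.exp_le_one_iff.2 ?_)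
    have : 0 ≤ (a : ℝ) * t := by positivity
    linarith

theorem aestronglyMeasurable_damp (hK : AEStronglyMeasurable K) (a : ℝ≥0) :
    AEStronglyMeasurable (damp a K) := by
  refine AEStronglyMeasurable.mul (Continuous.aestronglyMeasurable ?_) hK
  fun_prop

theorem integrable_damp (hK : Integrable K) (hK0 : ∀ t ≤ 0, K t = 0) (a : ℝ≥0) :
    Integrable (damp a K) :=
  hK.mono (aestronglyMeasurable_damp hK.1 a) (Eventually.of_forall (norm_damp_le hK0 a))

/-- Dominated convergence, causality making `|K|` a majorant. A kernel of `L¹` norm below `1` starts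
the continuity method and gives the contraction for uniqueness. -/
theorem tendsto_integral_norm_damp (hK : Integrable K) (hK0 : ∀ t ≤ 0, K t = 0) :
    Tendsto (fun n : ℕ => ∫ t, ‖damp n K t‖) atTop (𝓝 0) := by
  have := tendsto_integral_of_dominated_convergence (μ := volume) (F := fun (n : ℕ) t => ‖damp n K t‖)
    (f := fun _ => 0) (fun t => ‖K t‖) (fun n => (aestronglyMeasurable_damp hK.1 _).norm) hK.norm
    (fun n => Eventually.of_forall fun t => by simpa using norm_damp_le hK0 n t)
    (Eventually.of_forall fun t => ?_)
  · simpa using this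
  · rcases le_or_gt t 0 with ht | ht
    · simp [damp, hK0 t ht]
    · simp only [norm_damp]
      have h1 : Tendsto (fun n : ℕ => (((n : ℝ≥0) : ℝ)) * t) atTop atTop := by
        simpa using tendsto_natCast_atTop_atTop.atTop_mul_const ht
      simpa using (Real.tendsto_exp_neg_atTop_nhds_zero.comp h1).mul_const ‖K t‖

theorem continuous_convL2_damp (hK : Integrable K) (hK0 : ∀ t ≤ 0, K t = 0) :
    Continuous fun a : ℝ≥0 => convL2 (damp a K) (integrable_damp hK hK0 a) := by
  rw [continuous_iff_continuousAt]
  intro a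
  rw [ContinuousAt, tendsto_iff_norm_sub_tendsto_zero]
  have hc : Continuous fun b : ℝ≥0 => ∫ t, ‖damp b K t - damp a K t‖ := by
    refine continuous_of_dominated (bound := fun t => 2 * ‖K t‖) (fun b => ?_) (fun b => ?_)
      (hK.norm.const_mul 2) (Eventually.of_forall fun t => ?_)
    · exact ((aestronglyMeasurable_damp hK.1 b).sub (aestronglyMeasurable_damp hK.1 a)).norm
    · refine Eventually.of_forall fun t => ?_
      rw [norm_norm, two_mul]
      exact (norm_sub_le _ _).trans (add_le_add (norm_damp_le hK0 b t) (norm_damp_le hK0 a t))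
    · unfold damp; fun_prop
  have h0 := hc.tendsto a
  simp only [sub_self, norm_zero, integral_zero] at h0
  refine squeeze_zero (fun _ => norm_nonneg _) (fun b => ?_) h0
  rw [convL2_sub]
  exact norm_convL2_le _

end Damp

/-! ### Invertibility of `1 - K *` on causal functions. -/

section Causal

variable {K : ℝ → ℂ}

/-- The subspace of functions in `L²(ℝ)` that vanish on `(-∞, 0]`. -/
noncomputable def causalL2 : Submodule ℂ (Lp ℂ 2 (volume : Measure ℝ)) :=
  (LpToLpRestrictCLM ℝ ℂ ℂ volume 2 (Set.Iic 0)).ker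

instance : CompleteSpace causalL2 :=
  (ContinuousLinearMap.isClosed_ker _).completeSpace_coe

theorem mem_causalL2 {u : Lp ℂ 2 (volume : Measure ℝ)} :
    u ∈ causalL2 ↔ ∀ᵐ t, t ≤ 0 → u t = 0 := by
  rw [causalL2, LinearMap.mem_ker, Lp.eq_zero_iff_ae_eq_zero]
  have h := LpToLpRestrictCLM_coeFn ℂ (Set.Iic (0 : ℝ)) u
  have e : (∀ᵐ t, t ≤ 0 → u t = 0) ↔ ∀ᵐ t ∂volume.restrict (Set.Iic (0 : ℝ)), u t = 0 :=
    (ae_restrict_iff' measurableSet_Iic).symm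
  rw [e]
  constructor
  · intro h'
    filter_upwards [h, h'] with t h1 h2
    exact h1.symm.trans h2
  · intro h'
    filter_upwards [h, h'] with t h1 h2
    exact h1.trans h2

/-- In `∫ K(y) u(x - y) dy` with `x ≤ 0`, either `y ≤ 0` or `x - y < 0`. -/
theorem convL2_mem_causalL2 (hK : Integrable K) (hK0 : ∀ t ≤ 0, K t = 0)
    {u : Lp ℂ 2 (volume : Measure ℝ)} (hu : u ∈ causalL2) : convL2 K hK u ∈ causalL2 := by
  rw [mem_causalL2] at hu ⊢
  filter_upwards [convL2_ae_eq hK u] with x hx hx0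
  rw [hx]
  refine integral_eq_zero_of_ae ?_
  filter_upwards [(quasiMeasurePreserving_sub_left_of_right_invariant volume x).ae hu] with y hy
  rcases le_or_gt y 0 with h | h
  · simp [hK0 y h]
  · simp [hy (by linarith)]

/-- The operator `1 - K *` on causal square-integrable functions. -/
noncomputable def oneSubConv (K : ℝ → ℂ) (hK : Integrable K) (hK0 : ∀ t ≤ 0, K t = 0) :
    causalL2 →L[ℂ] causalL2 :=
  1 - ((convL2 K hK).comp causalL2.subtypeL).codRestrict causalL2
    fun u => convL2_mem_causalL2 hK hK0 u.2

theorem coe_oneSubConv (hK : Integrable K) (hK0 : ∀ t ≤ 0, K t = 0) (u : causalL2) :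
    (oneSubConv K hK hK0 u : Lp ℂ 2 (volume : Measure ℝ)) = u - convL2 K hK u := by
  rfl

theorem continuous_oneSubConv_damp (hK : Integrable K) (hK0 : ∀ t ≤ 0, K t = 0) :
    Continuous fun a : ℝ≥0 => oneSubConv (damp a K) (integrable_damp hK hK0 a)
      fun _ ht => damp_of_nonpos hK0 a ht := by
  refine continuous_iff_continuousAt.2 fun a => ?_
  unfold ContinuousAt
  refine (tendsto_iff_norm_sub_tendsto_zero (E := causalL2 →L[ℂ] causalL2)).2 ?_
  have h0 := tendsto_iff_norm_sub_tendsto_zero.1 ((continuous_convL2_damp hK hK0).tendsto a)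
  refine squeeze_zero (fun _ => ContinuousLinearMap.opNorm_nonneg _) (fun b => ?_) h0
  refine ContinuousLinearMap.opNorm_le_bound _ (norm_nonneg _) fun u => ?_
  change ‖((u : Lp ℂ 2 (volume : Measure ℝ)) - convL2 (damp b K) (integrable_damp hK hK0 b) u)
    - (u - convL2 (damp a K) (integrable_damp hK hK0 a) u)‖ ≤ _ * ‖(u : Lp ℂ 2 (volume : Measure ℝ))‖
  rw [sub_sub_sub_cancel_left, norm_sub_rev, ← sub_apply]
  exact ContinuousLinearMap.le_opNorm _ _

theorem norm_lt_one_isUnit_oneSubConv (hK : Integrable K) (hK0 : ∀ t ≤ 0, K t = 0)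
    (h : ∫ t, ‖K t‖ < 1) : IsUnit (oneSubConv K hK hK0) := by
  have : ‖((convL2 K hK).comp causalL2.subtypeL).codRestrict causalL2
      fun u => convL2_mem_causalL2 hK hK0 u.2‖ < 1 := by
    refine lt_of_le_of_lt (ContinuousLinearMap.opNorm_le_bound _ (norm_nonneg (convL2 K hK))
      fun u => ?_) ((norm_convL2_le hK).trans_lt h)
    exact (convL2 K hK).le_opNorm u
  exact (Units.oneSub (R := causalL2 →L[ℂ] causalL2) _ this).isUnit

/-- The symbol bound at `a = 0` alone would not make the inverse preserve causality. The bounds for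
all `a ≥ 0` connect the operator, inside the causal subspace, to a strongly damped one inverted by a
Neumann series. -/
theorem isUnit_oneSubConv (hK : Integrable K) (hK0 : ∀ t ≤ 0, K t = 0) {κ : ℝ} (hκ : 0 < κ)
    (hst : ∀ (a : ℝ≥0) (ξ : ℝ), κ ≤ ‖1 - 𝓕 (damp a K) ξ‖) :
    IsUnit (oneSubConv K hK hK0) := by
  obtain ⟨n, hn⟩ := ((tendsto_integral_norm_damp hK hK0).eventually (gt_mem_nhds one_pos)).exists
  have := isUnit_of_continuous (continuous_oneSubConv_damp hK hK0) hκ (fun a u => by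
    change κ * ‖(u : Lp ℂ 2 (volume : Measure ℝ))‖ ≤
      ‖(u : Lp ℂ 2 (volume : Measure ℝ)) - convL2 (damp a K) (integrable_damp hK hK0 a) u‖
    exact le_norm_sub_convL2 _ (hst a) _) (i₀ := (n : ℝ≥0))
    (norm_lt_one_isUnit_oneSubConv _ _ hn) 0
  convert this using 2
  exact (damp_zero K).symm

end Causal

/-! ### Uniqueness of locally integrable solutions. -/

section Uniqueness

theorem lintegral_lconvolution_eq {f g : ℝ → ℝ≥0∞} (hf : AEMeasurable f) (hg : AEMeasurable g) :
    ∫⁻ x, ∫⁻ y, f y * g (x - y) = (∫⁻ y, f y) * ∫⁻ y, g y := by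
  have hm : AEMeasurable (fun p : ℝ × ℝ => f p.2 * g (p.1 - p.2)) (volume.prod volume) :=
    (hf.comp_snd).mul (hg.comp_quasiMeasurePreserving
      (quasiMeasurePreserving_sub_of_right_invariant volume volume))
  rw [lintegral_lintegral_swap hm, ← lintegral_mul_const'' _ hf]
  refine lintegral_congr fun y => ?_
  have hy : AEMeasurable (fun x => g (x - y)) := hg.comp_quasiMeasurePreserving
    (measurePreserving_sub_right volume y).quasiMeasurePreserving
  rw [lintegral_const_mul'' _ hy, lintegral_sub_right_eq_self g]

variable {K d : ℝ → ℂ}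

/-- Causality: at times `x ≤ T` only values of `d` before `T` enter, so a locally integrable `d` can
be truncated to an integrable one. -/
theorem convolution_integrand_indicator_Iic (hK0 : ∀ t ≤ 0, K t = 0) (d : ℝ → ℂ) {x T : ℝ}
    (hx : x ≤ T) (y : ℝ) : K y * (Set.Iic T).indicator d (x - y) = K y * d (x - y) := by
  rcases le_or_gt y 0 with h | h
  · simp [hK0 y h]
  · rw [Set.indicator_of_mem (by simp only [Set.mem_Iic]; linarith)]

theorem convolution_indicator_Iic (hK0 : ∀ t ≤ 0, K t = 0) (d : ℝ → ℂ) {x T : ℝ} (hx : x ≤ T) :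
    (K ⋆[ContinuousLinearMap.mul ℂ ℂ] (Set.Iic T).indicator d) x =
      (K ⋆[ContinuousLinearMap.mul ℂ ℂ] d) x := by
  refine integral_congr_ae (Eventually.of_forall fun y => ?_)
  exact convolution_integrand_indicator_Iic hK0 d hx y

theorem ae_convolutionExistsAt_of_integrableOn_Iic (hK : Integrable K) (hK0 : ∀ t ≤ 0, K t = 0)
    (hd : ∀ T, IntegrableOn d (Set.Iic T)) :
    ∀ᵐ x, ConvolutionExistsAt K d x (ContinuousLinearMap.mul ℂ ℂ) := by
  have : ∀ n : ℕ, ∀ᵐ x, ConvolutionExistsAt K ((Set.Iic (n : ℝ)).indicator d) x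
      (ContinuousLinearMap.mul ℂ ℂ) := fun n =>
    hK.ae_convolution_exists _ ((hd n).integrable_indicator measurableSet_Iic)
  filter_upwards [ae_all_iff.2 this] with x hx
  obtain ⟨n, hn⟩ := exists_nat_ge x
  refine (hx n).congr (Eventually.of_forall fun y => ?_)
  exact convolution_integrand_indicator_Iic hK0 d hn y

/-- The homogeneous Volterra equation with an integrable kernel has only the trivial locally
integrable solution. -/
theorem ae_eq_zero_of_volterra (hK : Integrable K) (hK0 : ∀ t ≤ 0, K t = 0)
    (hd0 : ∀ t ≤ 0, d t = 0) (hd : ∀ T, IntegrableOn d (Set.Iic T))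
    (heq : ∀ᵐ t, d t = (K ⋆[ContinuousLinearMap.mul ℂ ℂ] d) t) : ∀ᵐ t, d t = 0 := by
  obtain ⟨n, hn⟩ := ((tendsto_integral_norm_damp hK hK0).eventually (gt_mem_nhds one_pos)).exists
  have hKn := integrable_damp hK hK0 n
  have hlt : ∫⁻ t, ‖damp n K t‖ₑ < 1 := by
    rw [integral_norm_eq_lintegral_enorm hKn.1] at hn
    rwa [← ENNReal.toReal_lt_toReal hKn.2.ne ENNReal.one_ne_top, ENNReal.toReal_one]
  have key : ∀ T : ℝ, ∀ᵐ t, (Set.Iic T).indicator d t = 0 := by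
    intro T
    set dT := (Set.Iic T).indicator d with hdT
    have hdTi : Integrable dT := (hd T).integrable_indicator measurableSet_Iic
    have hdT0 : ∀ t ≤ 0, dT t = 0 := fun t ht => by
      simp only [hdT, Set.indicator_apply, hd0 t ht, ite_self]
    have hei := integrable_damp hdTi hdT0 n
    -- The truncated function satisfies only an inequality: beyond `T` it vanishes while the
    -- convolution need not. Damping commutes with convolution because `e^{-nx} = e^{-ny}
    -- e^{-n(x-y)}`.
    have hle : ∀ᵐ x, ‖damp n dT x‖ₑ ≤ ∫⁻ y, ‖damp n K y‖ₑ * ‖damp n dT (x - y)‖ₑ := by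
      filter_upwards [heq] with x hx
      rcases le_or_gt x T with h | h
      · have h1 : dT x = (K ⋆[ContinuousLinearMap.mul ℂ ℂ] dT) x := by
          rw [hdT, convolution_indicator_Iic hK0 d h, ← hx, Set.indicator_of_mem (by exact h)]
        have h2 : damp n dT x = (damp n K ⋆[ContinuousLinearMap.mul ℂ ℂ] damp n dT) x := by
          rw [damp, h1, convolution_def, convolution_def, ← integral_const_mul]
          refine integral_congr_ae (Eventually.of_forall fun y => ?_)
          simp only [ContinuousLinearMap.mul_apply', damp]
          rw [show -(((n : ℝ≥0) : ℝ) * x) = -(((n : ℝ≥0) : ℝ) * y) + -(((n : ℝ≥0) : ℝ) * (x - y))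
            by ring, Real.exp_add]
          push_cast
          ring
        rw [h2]
        exact enorm_convolution_le _ _ _
      · simp [damp, hdT, Set.indicator_of_notMem (show x ∉ Set.Iic T by simpa using h)]
    have h3 := (lintegral_mono_ae hle).trans_eq
      (lintegral_lconvolution_eq hKn.1.enorm hei.1.enorm)
    -- A finite quantity bounded by a factor below `1` times itself is zero.
    have h4 : ∫⁻ x, ‖damp n dT x‖ₑ = 0 := by
      by_contra hne
      have := ENNReal.mul_lt_mul_left hne hei.2.ne hlt
      rw [one_mul] at this
      exact absurd h3 (not_le.2 this)
    rw [lintegral_eq_zero_iff' hei.1.enorm] at h4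
    filter_upwards [h4] with t ht
    simpa [damp] using ht
  have : ∀ᵐ t, ∀ n : ℕ, (Set.Iic (n : ℝ)).indicator d t = 0 := ae_all_iff.2 fun n => key n
  filter_upwards [this] with t ht
  obtain ⟨n, hn⟩ := exists_nat_ge t
  rw [← ht n, Set.indicator_of_mem (by exact hn)]

end Uniqueness

/-! ### The unweighted `L²` estimate. -/

theorem memLp_integrableOn_Iic {u : ℝ → ℂ} (hu : MemLp u 2) (hu0 : ∀ t ≤ 0, u t = 0) (T : ℝ) :
    IntegrableOn u (Set.Iic T) := by
  have h1 : IntegrableOn u (Set.Ioc 0 T) :=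
    ((hu.restrict (Set.Ioc 0 T)).mono_exponent (by norm_num)).integrable le_rfl
  have h2 : IntegrableOn u (Set.Iic 0) :=
    (integrableOn_zero).congr_fun (fun t ht => (hu0 t ht).symm) measurableSet_Iic
  exact (h2.union h1).mono_set fun t ht => by
    rcases le_or_gt t 0 with h | h
    · exact Or.inl h
    · exact Or.inr ⟨h, ht⟩

/-- The `L²` estimate for Volterra equations satisfying the Paley–Wiener condition. -/
theorem volterra_eLpNorm_le {K H φ : ℝ → ℂ} {κ : ℝ} (hκ : 0 < κ) (hK : Integrable K)
    (hK0 : ∀ t ≤ 0, K t = 0) (hst : ∀ (a : ℝ≥0) (ξ : ℝ), κ ≤ ‖1 - 𝓕 (damp a K) ξ‖)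
    (hH : MemLp H 2) (hH0 : ∀ t ≤ 0, H t = 0)
    (hφ : ∀ T, IntegrableOn φ (Set.Iic T)) (hφ0 : ∀ t ≤ 0, φ t = 0)
    (heq : ∀ᵐ t, φ t = H t + (K ⋆[ContinuousLinearMap.mul ℂ ℂ] φ) t) :
    MemLp φ 2 ∧ eLpNorm φ 2 volume ≤ ENNReal.ofReal κ⁻¹ * eLpNorm H 2 volume := by
  have hHm : hH.toLp ∈ causalL2 := by
    rw [mem_causalL2]
    filter_upwards [hH.coeFn_toLp] with t h1 h2
    rw [h1, hH0 t h2]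
  obtain ⟨x, hx⟩ := isUnit_oneSubConv hK hK0 hκ hst
  set u : causalL2 := (↑x⁻¹ : causalL2 →L[ℂ] causalL2) ⟨hH.toLp, hHm⟩ with hu
  have hu1 : oneSubConv K hK hK0 u = ⟨hH.toLp, hHm⟩ := by
    rw [hu, ← hx, ← mul_apply_eq_comp, Units.mul_inv, one_apply_eq_self]
  have hu2 : (u : Lp ℂ 2 (volume : Measure ℝ)) - convL2 K hK u = hH.toLp := by
    rw [← coe_oneSubConv hK hK0, hu1]
  -- A representative of `u` vanishing at every `t ≤ 0`, as the uniqueness theorem asks, and not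
  -- just almost everywhere.
  set v : ℝ → ℂ := (Set.Ioi 0).indicator (u : Lp ℂ 2 (volume : Measure ℝ)) with hv
  have hv0 : ∀ t ≤ 0, v t = 0 := fun t ht => Set.indicator_of_notMem (by simpa using ht) _
  have hvu : v =ᵐ[volume] (u : Lp ℂ 2 (volume : Measure ℝ)) := by
    filter_upwards [mem_causalL2.1 u.2] with t ht
    rcases le_or_gt t 0 with h | h
    · rw [hv0 t h, ht h]
    · exact Set.indicator_of_mem (by exact h) _
  have hvL : MemLp v 2 := (memLp_congr_ae hvu).2 (Lp.memLp _)
  have hveq : ∀ᵐ t, v t = H t + (K ⋆[ContinuousLinearMap.mul ℂ ℂ] v) t := by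
    rw [convolution_congr _ EventuallyEq.rfl hvu]
    filter_upwards [hvu, Lp.coeFn_sub (u : Lp ℂ 2 (volume : Measure ℝ)) (convL2 K hK u),
      convL2_ae_eq hK u, hH.coeFn_toLp] with t h1 h2 h3 h4
    rw [hu2, h4, Pi.sub_apply, h3] at h2
    rw [h1, h2]; ring
  have hvI := memLp_integrableOn_Iic hvL hv0
  have hd := ae_eq_zero_of_volterra hK hK0 (d := fun t => φ t - v t)
    (fun t ht => by simp [hφ0 t ht, hv0 t ht]) (fun T => (hφ T).sub (hvI T)) (by
      filter_upwards [heq, hveq, ae_convolutionExistsAt_of_integrableOn_Iic hK hK0 hφ,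
        ae_convolutionExistsAt_of_integrableOn_Iic hK hK0 hvI] with t h1 h2 h3 h4
      rw [h1, h2, convolution_def, convolution_def, convolution_def, add_sub_add_left_eq_sub,
        ← integral_sub h3 h4]
      simp [mul_sub])
  have hφv : φ =ᵐ[volume] v := by
    filter_upwards [hd] with t ht
    exact sub_eq_zero.1 ht
  refine ⟨(memLp_congr_ae hφv).2 hvL, ?_⟩
  have hn := le_norm_sub_convL2 hK (κ := κ) (fun ξ => by simpa [damp_zero] using hst 0 ξ)
    (u : Lp ℂ 2 (volume : Measure ℝ))
  rw [hu2, Lp.norm_toLp, Lp.norm_def, ← le_inv_mul_iff₀ hκ] at hn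
  rw [eLpNorm_congr_ae (hφv.trans hvu), ← ENNReal.ofReal_toReal (Lp.eLpNorm_ne_top _),
    ← ENNReal.ofReal_toReal hH.eLpNorm_ne_top, ← ENNReal.ofReal_mul (by positivity)]
  exact ENNReal.ofReal_le_ofReal hn

/-! ### Polynomial weights in time. -/

/-- Multiplication by the weight `(1 + μ t)ⁿ`. -/
noncomputable def timeWeight (μ : ℝ) (n : ℕ) (u : ℝ → ℂ) (t : ℝ) : ℂ :=
  (((1 + μ * t) ^ n : ℝ) : ℂ) * u t

section TimeWeight

variable {μ : ℝ} {u K : ℝ → ℂ}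

theorem timeWeight_zero (μ : ℝ) (u : ℝ → ℂ) : timeWeight μ 0 u = u := by
  ext t; simp [timeWeight]

theorem timeWeight_succ (μ : ℝ) (n : ℕ) (u : ℝ → ℂ) :
    timeWeight μ (n + 1) u = timeWeight μ n u + timeWeight μ n (fun t => ((μ * t : ℝ) : ℂ) * u t) := by
  ext t
  simp only [timeWeight, Pi.add_apply, pow_succ]
  push_cast
  ring

theorem aestronglyMeasurable_timeWeight (hu : AEStronglyMeasurable u) (n : ℕ) :
    AEStronglyMeasurable (timeWeight μ n u) := by
  refine AEStronglyMeasurable.mul (Continuous.aestronglyMeasurable ?_) hu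
  fun_prop

theorem norm_timeWeight_mono (hμ : 0 ≤ μ) (hu0 : ∀ t ≤ 0, u t = 0) {m n : ℕ} (h : m ≤ n) (t : ℝ) :
    ‖timeWeight μ m u t‖ ≤ ‖timeWeight μ n u t‖ := by
  rcases le_or_gt t 0 with ht | ht
  · simp [timeWeight, hu0 t ht]
  · have h1 : 1 ≤ 1 + μ * t := by nlinarith
    simp only [timeWeight, norm_mul, Complex.norm_real, norm_pow]
    have h2 : 1 ≤ ‖1 + μ * t‖ := h1.trans (le_abs_self _)
    gcongr

theorem norm_timeWeight_mul_le (hμ : 0 ≤ μ) (hu0 : ∀ t ≤ 0, u t = 0) (n : ℕ) (t : ℝ) :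
    ‖timeWeight μ n (fun t => ((μ * t : ℝ) : ℂ) * u t) t‖ ≤ ‖timeWeight μ (n + 1) u t‖ := by
  rcases le_or_gt t 0 with ht | ht
  · simp [timeWeight, hu0 t ht]
  · have h1 : 0 ≤ μ * t := by positivity
    have h2 : ‖μ * t‖ ≤ ‖1 + μ * t‖ := by
      rw [Real.norm_of_nonneg h1, Real.norm_of_nonneg (by positivity)]
      linarith
    simp only [timeWeight]
    rw [norm_mul, norm_mul (((μ * t : ℝ) : ℂ)), norm_mul _ (u t), Complex.norm_real,
      Complex.norm_real, Complex.norm_real, pow_succ, norm_mul _ (1 + μ * t), mul_assoc]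
    gcongr

theorem convolution_eq_zero_of_nonpos (hK0 : ∀ t ≤ 0, K t = 0) (hu0 : ∀ t ≤ 0, u t = 0) {t : ℝ}
    (ht : t ≤ 0) : (K ⋆[ContinuousLinearMap.mul ℂ ℂ] u) t = 0 := by
  refine integral_eq_zero_of_ae (Eventually.of_forall fun y => ?_)
  rcases le_or_gt y 0 with h | h
  · simp [hK0 y h]
  · simp [hu0 (t - y) (by linarith)]

/-- The weight is submultiplicative: `1 + μt ≤ (1 + μy)(1 + μ(t - y))` when `y` and `t - y` are
nonnegative, and otherwise the integrand vanishes. -/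
theorem enorm_timeWeight_convolution_le (hμ : 0 ≤ μ) (hK0 : ∀ t ≤ 0, K t = 0)
    (hu0 : ∀ t ≤ 0, u t = 0) (n : ℕ) (t : ℝ) :
    ‖timeWeight μ n (K ⋆[ContinuousLinearMap.mul ℂ ℂ] u) t‖ₑ ≤
      ∫⁻ y, ‖timeWeight μ n K y‖ₑ * ‖timeWeight μ n u (t - y)‖ₑ := by
  rw [timeWeight, convolution_def, ← integral_const_mul]
  refine (enorm_integral_le_lintegral_enorm _).trans (lintegral_mono fun y => ?_)
  rw [← enorm_mul, enorm_le_iff_norm_le, ContinuousLinearMap.mul_apply']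
  rcases le_or_gt y 0 with h | h
  · simpa [hK0 y h] using by positivity
  rcases le_or_gt (t - y) 0 with h' | h'
  · simpa [hu0 _ h'] using by positivity
  have h1 : 0 ≤ μ * y := by positivity
  have h2 : 0 ≤ μ * (t - y) := by positivity
  have h3 : 0 ≤ 1 + μ * t := by nlinarith
  have h4 : (1 + μ * t) ^ n ≤ (1 + μ * y) ^ n * (1 + μ * (t - y)) ^ n := by
    rw [← mul_pow]
    gcongr
    nlinarith [mul_nonneg h1 h2]
  simp only [timeWeight, norm_mul, Complex.norm_real]
  rw [Real.norm_of_nonneg (by positivity), Real.norm_of_nonneg (by positivity),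
    Real.norm_of_nonneg (by positivity)]
  calc (1 + μ * t) ^ n * (‖K y‖ * ‖u (t - y)‖)
      ≤ ((1 + μ * y) ^ n * (1 + μ * (t - y)) ^ n) * (‖K y‖ * ‖u (t - y)‖) := by gcongr
    _ = _ := by ring

theorem eLpNorm_timeWeight_convolution_le (hμ : 0 ≤ μ) (hK0 : ∀ t ≤ 0, K t = 0)
    (hu0 : ∀ t ≤ 0, u t = 0) (hK : AEStronglyMeasurable K) (hu : AEStronglyMeasurable u) (n : ℕ) :
    eLpNorm (timeWeight μ n (K ⋆[ContinuousLinearMap.mul ℂ ℂ] u)) 2 volume ≤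
      (∫⁻ y, ‖timeWeight μ n K y‖ₑ) * eLpNorm (timeWeight μ n u) 2 volume := by
  refine eLpNorm_two_le_of_lintegral_le ?_
  rw [mul_pow, eLpNorm_two_sq]
  refine (lintegral_mono fun x => ?_).trans (lintegral_sq_lconvolution_le
    (aestronglyMeasurable_timeWeight (μ := μ) hK n).enorm
    (aestronglyMeasurable_timeWeight (μ := μ) hu n).enorm)
  gcongr
  exact enorm_timeWeight_convolution_le hμ hK0 hu0 n x

end TimeWeight

/-- Weighted `L²` estimates for Volterra equations satisfying the Paley–Wiener condition, for a
kernel whose `n`-th moment is finite. -/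
theorem volterra_timeWeight (A : ℝ≥0) {κ : ℝ} (hκ : 0 < κ) (n : ℕ) :
    ∃ C : ℝ≥0, ∀ (μ : ℝ) (K H φ : ℝ → ℂ), 0 ≤ μ → AEStronglyMeasurable K →
      (∀ t ≤ 0, K t = 0) → (∫⁻ t, ‖timeWeight μ n K t‖ₑ) ≤ A →
      (∀ (a : ℝ≥0) (ξ : ℝ), κ ≤ ‖1 - 𝓕 (damp a K) ξ‖) →
      AEStronglyMeasurable H → eLpNorm (timeWeight μ n H) 2 volume < ∞ → (∀ t ≤ 0, H t = 0) →
      AEStronglyMeasurable φ → (∀ T, IntegrableOn φ (Set.Iic T)) → (∀ t ≤ 0, φ t = 0) →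
      (∀ᵐ t, φ t = H t + (K ⋆[ContinuousLinearMap.mul ℂ ℂ] φ) t) →
      eLpNorm (timeWeight μ n φ) 2 volume ≤ C * eLpNorm (timeWeight μ n H) 2 volume := by
  induction n with
  | zero =>
    refine ⟨κ⁻¹.toNNReal, fun μ K H φ hμ hK hK0 hKA hst hH hH2 hH0 hφ hφi hφ0 heq => ?_⟩
    simp only [timeWeight_zero] at *
    exact (volterra_eLpNorm_le hκ ⟨hK, hKA.trans_lt ENNReal.coe_lt_top⟩ hK0 hst ⟨hH, hH2⟩ hH0 hφi
      hφ0 heq).2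
  | succ n ih =>
    obtain ⟨C, hC⟩ := ih
    -- The first `C` bounds `φ`, the rest bounds `μtφ`: its source has weighted norm at most `1 +
    -- AC` times that of `H`.
    refine ⟨C + C * (1 + A * C), fun μ K H φ hμ hK hK0 hKA hst hH hH2 hH0 hφ hφi hφ0 heq => ?_⟩
    have hKn : ∀ m ≤ n + 1, (∫⁻ t, ‖timeWeight μ m K t‖ₑ) ≤ A := fun m hm =>
      (lintegral_mono fun t => enorm_le_iff_norm_le.2
        (norm_timeWeight_mono hμ hK0 hm t)).trans hKA
    have hHn : eLpNorm (timeWeight μ n H) 2 volume ≤ eLpNorm (timeWeight μ (n + 1) H) 2 volume :=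
      eLpNorm_mono fun t => norm_timeWeight_mono hμ hH0 n.le_succ t
    have hφn : eLpNorm (timeWeight μ n φ) 2 volume ≤
        C * eLpNorm (timeWeight μ (n + 1) H) 2 volume :=
      (hC μ K H φ hμ hK hK0 (hKn n n.le_succ) hst hH (hHn.trans_lt hH2) hH0 hφ hφi hφ0 heq).trans
        (by gcongr)
    set lin : (ℝ → ℂ) → ℝ → ℂ := fun u t => ((μ * t : ℝ) : ℂ) * u t with hlin
    have lin_meas : ∀ {u : ℝ → ℂ}, AEStronglyMeasurable u → AEStronglyMeasurable (lin u) :=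
      fun hu => AEStronglyMeasurable.mul (Continuous.aestronglyMeasurable (by fun_prop)) hu
    have lin_zero : ∀ {u : ℝ → ℂ}, (∀ t ≤ 0, u t = 0) → ∀ t ≤ 0, lin u t = 0 :=
      fun hu t ht => by simp [hlin, hu t ht]
    have hK1 : (∫⁻ t, ‖timeWeight μ n (lin K) t‖ₑ) ≤ A :=
      (lintegral_mono fun t => enorm_le_iff_norm_le.2 (norm_timeWeight_mul_le hμ hK0 n t)).trans hKA
    have hKi : Integrable K := ⟨hK, by
      simpa [timeWeight_zero, HasFiniteIntegral] using (hKn 0 (Nat.zero_le _)).trans_lt ENNReal.coe_lt_top⟩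
    have hK1i : Integrable (lin K) := ⟨lin_meas hK, by
      refine lt_of_le_of_lt (lintegral_mono fun t => enorm_le_iff_norm_le.2 ?_)
        (hK1.trans_lt ENNReal.coe_lt_top)
      simpa [timeWeight_zero] using
        norm_timeWeight_mono (u := lin K) hμ (lin_zero hK0) (Nat.zero_le n) t⟩
    have hψi : ∀ T, IntegrableOn (lin φ) (Set.Iic T) := fun T => by
      refine ((hφi T).norm.const_mul (μ * |T|)).mono' (lin_meas hφ).restrict ?_
      filter_upwards [ae_restrict_mem measurableSet_Iic] with t ht
      rcases le_or_gt t 0 with h | h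
      · simp [hlin, hφ0 t h]
      · simp only [hlin, norm_mul, Complex.norm_real]
        have h2 : ‖t‖ ≤ |T| := by
          rw [Real.norm_of_nonneg h.le]; exact (Set.mem_Iic.1 ht).trans (le_abs_self T)
        rw [Real.norm_of_nonneg hμ]
        gcongr
    -- The source of the equation for `μtφ`. It contains `φ` only through `(μtK) * φ`, which the
    -- induction hypothesis already controls.
    set H1 : ℝ → ℂ := lin H + (lin K ⋆[ContinuousLinearMap.mul ℂ ℂ] φ) with hH1
    have hH1m : AEStronglyMeasurable H1 :=
      (lin_meas hH).add (aestronglyMeasurable_convolution (lin_meas hK) hφ)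
    have hH1le : eLpNorm (timeWeight μ n H1) 2 volume ≤
        (1 + A * C) * eLpNorm (timeWeight μ (n + 1) H) 2 volume := by
      have e : timeWeight μ n H1 = timeWeight μ n (lin H) +
          timeWeight μ n (lin K ⋆[ContinuousLinearMap.mul ℂ ℂ] φ) := by
        ext t; simp [timeWeight, hH1, mul_add]
      rw [e, add_mul, one_mul]
      refine (eLpNorm_add_le (aestronglyMeasurable_timeWeight (lin_meas hH) n)
        (aestronglyMeasurable_timeWeight
          (aestronglyMeasurable_convolution (lin_meas hK) hφ) n) (by norm_num)).trans ?_
      refine add_le_add (eLpNorm_mono fun t => norm_timeWeight_mul_le hμ hH0 n t) ?_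
      refine (eLpNorm_timeWeight_convolution_le hμ (lin_zero hK0) hφ0 (lin_meas hK) hφ n).trans ?_
      rw [mul_assoc]
      gcongr
    have hψ : eLpNorm (timeWeight μ n (lin φ)) 2 volume ≤
        C * ((1 + A * C) * eLpNorm (timeWeight μ (n + 1) H) 2 volume) := by
      refine (hC μ K H1 (lin φ) hμ hK hK0 (hKn n n.le_succ) hst hH1m ?_ ?_ (lin_meas hφ) hψi
        (lin_zero hφ0) ?_).trans (by gcongr)
      · refine hH1le.trans_lt (ENNReal.mul_lt_top ?_ hH2)
        exact_mod_cast ENNReal.coe_lt_top (r := 1 + A * C)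
      · intro t ht
        simp only [hH1, Pi.add_apply, lin_zero hH0 t ht,
          convolution_eq_zero_of_nonpos (lin_zero hK0) hφ0 ht, add_zero]
      · filter_upwards [heq, ae_convolutionExistsAt_of_integrableOn_Iic hKi hK0 hφi,
          ae_convolutionExistsAt_of_integrableOn_Iic hK1i (lin_zero hK0) hφi,
          ae_convolutionExistsAt_of_integrableOn_Iic hKi hK0 hψi] with t h1 h2 h3 h4
        have e : ((μ * t : ℝ) : ℂ) * (K ⋆[ContinuousLinearMap.mul ℂ ℂ] φ) t =
            (lin K ⋆[ContinuousLinearMap.mul ℂ ℂ] φ) t +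
              (K ⋆[ContinuousLinearMap.mul ℂ ℂ] lin φ) t := by
          rw [convolution_def, convolution_def, convolution_def, ← integral_const_mul,
            ← integral_add h3 h4]
          refine integral_congr_ae (Eventually.of_forall fun y => ?_)
          simp only [hlin, ContinuousLinearMap.mul_apply']
          push_cast
          ring
        simp only [hH1, Pi.add_apply]
        rw [add_assoc, ← e]
        simp only [hlin]
        rw [h1]
        ring
    rw [timeWeight_succ]
    refine (eLpNorm_add_le (aestronglyMeasurable_timeWeight hφ n)
      (aestronglyMeasurable_timeWeight (lin_meas hφ) n) (by norm_num)).trans ?_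
    refine (add_le_add hφn hψ).trans_eq ?_
    push_cast
    ring

/-! ### The weighted Sobolev norm. -/

section Sobolev

variable {σ : ℝ} {f g : E3 → ℂ}

theorem memLp_of_sobolevNorm_lt_top (h : sobolevNorm σ f < ∞) : MemLp f 2 := by
  by_contra hf
  simp [sobolevNorm, hf] at h

theorem sobolevNorm_of_memLp (hf : MemLp f 2) :
    sobolevNorm σ f = eLpNorm (fun ξ : E3 => (((1 + ‖(2 * Real.pi) • ξ‖ ^ 2) ^ (σ / 2) : ℝ) : ℂ) *
      (𝓕 (hf.toLp f) : Lp ℂ 2 (volume : Measure E3)) ξ) 2 volume := by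
  simp [sobolevNorm, hf]

theorem continuous_sobolevWeight (σ : ℝ) :
    Continuous fun ξ : E3 => (1 + ‖(2 * Real.pi) • ξ‖ ^ 2) ^ (σ / 2) := by
  refine Continuous.rpow_const (by fun_prop) fun ξ => Or.inl ?_
  positivity

theorem sobolevNorm_add_le (σ : ℝ) (f g : E3 → ℂ) :
    sobolevNorm σ (f + g) ≤ sobolevNorm σ f + sobolevNorm σ g := by
  by_cases hf : MemLp f 2
  swap; · simp [sobolevNorm, hf]
  by_cases hg : MemLp g 2
  swap; · simp [sobolevNorm, hg]
  have hw := (Complex.continuous_ofReal.comp (continuous_sobolevWeight σ)).aestronglyMeasurable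
    (μ := (volume : Measure E3))
  rw [sobolevNorm_of_memLp hf, sobolevNorm_of_memLp hg, sobolevNorm_of_memLp (hf.add hg)]
  refine le_trans (le_of_eq (eLpNorm_congr_ae ?_)) (eLpNorm_add_le
    (hw.mul (Lp.aestronglyMeasurable _)) (hw.mul (Lp.aestronglyMeasurable _)) (by norm_num))
  rw [MemLp.toLp_add hf hg, FourierAdd.fourier_add]
  filter_upwards [Lp.coeFn_add (𝓕 (hf.toLp f) : Lp ℂ 2 (volume : Measure E3))
    (𝓕 (hg.toLp g))] with ξ h
  simp only [h, Pi.add_apply, mul_add]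

theorem sobolevNorm_sum_le {ι : Type*} (σ : ℝ) (S : Finset ι) (F : ι → E3 → ℂ) (f : E3 → ℂ) :
    sobolevNorm σ (f + ∑ i ∈ S, F i) ≤ sobolevNorm σ f + ∑ i ∈ S, sobolevNorm σ (F i) := by
  classical
  induction S using Finset.induction_on generalizing f with
  | empty => simp
  | insert i S hi ih =>
    rw [Finset.sum_insert hi, Finset.sum_insert hi, ← add_assoc, ← add_assoc]
    exact (ih _).trans (by gcongr; exact sobolevNorm_add_le _ _ _)

/-- The weighted norm with two moments controls `(1 + |v|²) f`. -/
theorem sobolevNorm_one_add_sq_mul_le (σ : ℝ) {M : ℕ} (hM : 2 ≤ M) (f : E3 → ℝ) :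
    sobolevNorm σ (fun v => (((1 + ‖v‖ ^ 2) * f v : ℝ) : ℂ)) ≤ weightedSobolevNorm σ M f := by
  set N : (Fin 3 → ℕ) → ℝ≥0∞ := fun a =>
    sobolevNorm σ (fun v : E3 => (((∏ i, v i ^ a i) * f v : ℝ) : ℂ)) with hN
  -- `1 + |v|²` is the monomial of degree `0` plus the three squares `v_j²`; hence two moments are
  -- needed.
  have h1 : (fun v : E3 => (((1 + ‖v‖ ^ 2) * f v : ℝ) : ℂ)) =
      (fun v : E3 => (((∏ i, v i ^ (0 : Fin 3 → ℕ) i) * f v : ℝ) : ℂ)) +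
      ∑ j, fun v : E3 => (((∏ i, v i ^ (Pi.single j 2 : Fin 3 → ℕ) i) * f v : ℝ) : ℂ) := by
    ext v
    have h : ‖v‖ ^ 2 = ∑ i, v i ^ 2 := by simp [EuclideanSpace.norm_sq_eq]
    rw [h]
    simp [Fin.sum_univ_three, Pi.single_apply]
    ring
  rw [h1]
  refine (sobolevNorm_sum_le σ Finset.univ _ _).trans ?_
  have h2 : N 0 ≤ ∑ a ∈ Finset.piAntidiag (Finset.univ : Finset (Fin 3)) 0, N a :=
    Finset.single_le_sum (f := N) (fun _ _ => zero_le) (by simp)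
  have h3 : ∑ j, N (Pi.single j 2) ≤
      ∑ a ∈ Finset.piAntidiag (Finset.univ : Finset (Fin 3)) 2, N a := by
    rw [← Finset.sum_image (f := N) (g := fun j : Fin 3 => (Pi.single j 2 : Fin 3 → ℕ))
      (fun i _ j _ hij => by
        by_contra hne
        have := congrFun hij i
        simp [hne] at this)]
    refine Finset.sum_le_sum_of_subset fun a ha => ?_
    obtain ⟨j, -, rfl⟩ := Finset.mem_image.1 ha
    simp [Finset.mem_piAntidiag]
  have h4 : ∑ n ∈ ({0, 2} : Finset ℕ), ∑ a ∈ Finset.piAntidiag (Finset.univ : Finset (Fin 3)) n, N a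
      ≤ weightedSobolevNorm σ M f :=
    Finset.sum_le_sum_of_subset fun n hn => by
      simp only [Finset.mem_insert, Finset.mem_singleton, Finset.mem_range] at hn ⊢
      omega
  rw [Finset.sum_pair (by norm_num)] at h4
  exact (add_le_add h2 h3).trans h4

end Sobolev

/-! ### Pairing with Gaussians, and the heat-flow representation of `f̂`. -/

section Gaussian

theorem norm_modulatedGaussian (r : ℝ) (x v : E3) :
    ‖Complex.exp (-(r : ℂ) * (‖v‖ : ℂ) ^ 2 + 2 * Real.pi * Complex.I * ((inner ℝ x v : ℝ) : ℂ))‖ =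
      Real.exp (-r * ‖v‖ ^ 2) := by
  rw [Complex.norm_exp]
  congr 1
  simp [← Complex.ofReal_pow]

theorem continuous_modulatedGaussian (r : ℝ) (x : E3) : Continuous fun v : E3 =>
    Complex.exp (-(r : ℂ) * (‖v‖ : ℂ) ^ 2 + 2 * Real.pi * Complex.I * ((inner ℝ x v : ℝ) : ℂ)) := by
  fun_prop

theorem integrable_gaussian {r : ℝ} (hr : 0 < r) :
    Integrable fun v : E3 => Real.exp (-r * ‖v‖ ^ 2) := by
  have := (GaussianFourier.integrable_cexp_neg_mul_sq_norm_add (V := E3) (b := (r : ℂ)) (by simpa)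
    0 0).norm
  refine this.congr (Filter.Eventually.of_forall fun v => ?_)
  simpa using norm_modulatedGaussian r 0 v

theorem integrable_modulatedGaussian {r : ℝ} (hr : 0 < r) (x : E3) : Integrable fun v : E3 =>
    Complex.exp (-(r : ℂ) * (‖v‖ : ℂ) ^ 2 + 2 * Real.pi * Complex.I * ((inner ℝ x v : ℝ) : ℂ)) :=
  (integrable_gaussian hr).mono' (continuous_modulatedGaussian r x).aestronglyMeasurable
    (Filter.Eventually.of_forall fun v => (norm_modulatedGaussian r x v).le)

theorem memLp_modulatedGaussian {r : ℝ} (hr : 0 < r) (x : E3) : MemLp (fun v : E3 =>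
    Complex.exp (-(r : ℂ) * (‖v‖ : ℂ) ^ 2 + 2 * Real.pi * Complex.I * ((inner ℝ x v : ℝ) : ℂ))) 2 := by
  rw [memLp_two_iff_integrable_sq_norm (continuous_modulatedGaussian r x).aestronglyMeasurable]
  refine (integrable_gaussian (r := 2 * r) (by positivity)).congr
    (Filter.Eventually.of_forall fun v => ?_)
  simp only
  rw [norm_modulatedGaussian, sq (Real.exp _), ← Real.exp_add]
  ring_nf

/-- Parseval's identity against a modulated Gaussian. -/
theorem enorm_integral_gaussian_mul_le {g : E3 → ℂ} (hg : MemLp g 2) {r : ℝ} (hr : 0 < r)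
    (η : E3) :
    ‖∫ v, Complex.exp (-(Complex.I * ((inner ℝ v η : ℝ) : ℂ))) *
        (g v * (Real.exp (-r * ‖v‖ ^ 2) : ℂ))‖ₑ ≤
      ∫⁻ ξ, ‖(𝓕 (hg.toLp g) : Lp ℂ 2 (volume : Measure E3)) ξ‖ₑ *
        ENNReal.ofReal ((Real.pi / r) ^ (3 / 2 : ℝ) *
          Real.exp (-‖η - (2 * Real.pi) • ξ‖ ^ 2 / (4 * r))) := by
  -- The rescaling matches `e^{-iv·η}` with the character `e^{-2πi v·x}`. The integral is then an
  -- `L²` inner product with a modulated Gaussian, whose transform is explicit.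
  set x : E3 := (2 * Real.pi)⁻¹ • η with hx
  have hη : η = (2 * Real.pi) • x := by rw [hx, smul_inv_smul₀ (by positivity)]
  have hL2 := memLp_modulatedGaussian hr x
  have h1 : ∫ v, Complex.exp (-(Complex.I * ((inner ℝ v η : ℝ) : ℂ))) *
      (g v * (Real.exp (-r * ‖v‖ ^ 2) : ℂ)) =
      inner ℂ (𝓕 (hL2.toLp) : Lp ℂ 2 (volume : Measure E3)) (𝓕 (hg.toLp g)) := by
    rw [Lp.inner_fourier_eq, L2.inner_def]
    refine integral_congr_ae ?_
    filter_upwards [hL2.coeFn_toLp, hg.coeFn_toLp] with v h2 h3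
    rw [h2, h3, RCLike.inner_apply, ← Complex.exp_conj, hη, inner_smul_right,
      real_inner_comm x v, Complex.ofReal_exp, mul_comm, mul_assoc, ← Complex.exp_add]
    congr 2
    have h4 : conj (2 : ℂ) = 2 := map_ofNat _ 2
    simp [Complex.conj_ofReal, h4]
    ring
  rw [h1, L2.inner_def]
  refine (enorm_integral_le_lintegral_enorm _).trans (lintegral_mono_ae ?_)
  filter_upwards [fourier_toLp_ae_eq (integrable_modulatedGaussian hr x) hL2] with ξ h2
  rw [h2, fourier_gaussian_innerProductSpace' (by simpa using hr),
    RCLike.inner_apply, enorm_mul, RCLike.enorm_conj]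
  gcongr
  rw [← ofReal_norm]
  refine ENNReal.ofReal_le_ofReal (le_of_eq ?_)
  have h3 : η - (2 * Real.pi) • ξ = (2 * Real.pi) • (x - ξ) := by rw [hη, smul_sub]
  rw [norm_mul, Complex.norm_exp, h3, norm_smul, ← Complex.ofReal_div,
    Complex.norm_cpow_eq_rpow_re_of_pos (by positivity)]
  congr 2
  · simp
  · rw [show (-(Real.pi : ℂ) ^ 2 * (‖x - ξ‖ : ℂ) ^ 2 / (r : ℂ)) =
      ((-Real.pi ^ 2 * ‖x - ξ‖ ^ 2 / r : ℝ) : ℂ) by push_cast; ring, Complex.ofReal_re,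
      Real.norm_of_nonneg (by positivity)]
    field_simp
    ring

end Gaussian

/-- A bound for the Fourier integral of `f` in terms of the `L²` Fourier transform of
`(1 + |v|²) f`, from `(1 + |v|²)⁻¹ = ∫₀^∞ e^{-r(1 + |v|²)} dr`. -/
theorem enorm_fourierHat_le {f : E3 → ℝ}
    (hg : MemLp (fun v => (((1 + ‖v‖ ^ 2) * f v : ℝ) : ℂ)) 2) (η : E3) :
    ‖fourierHat f η‖ₑ ≤ ∫⁻ r in Set.Ioi (0 : ℝ), ENNReal.ofReal (Real.exp (-r)) *
      ∫⁻ ξ, ‖(𝓕 (hg.toLp _) : Lp ℂ 2 (volume : Measure E3)) ξ‖ₑ *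
        ENNReal.ofReal ((Real.pi / r) ^ (3 / 2 : ℝ) *
          Real.exp (-‖η - (2 * Real.pi) • ξ‖ ^ 2 / (4 * r))) := by
  set g : E3 → ℂ := fun v => (((1 + ‖v‖ ^ 2) * f v : ℝ) : ℂ) with hgdef
  set e : E3 → ℂ := fun v => Complex.exp (-(Complex.I * ((inner ℝ v η : ℝ) : ℂ))) with he
  have hen : ∀ v, ‖e v‖ = 1 := fun v => by
    rw [he, Complex.norm_exp]; simp
  have hec : Continuous e := by rw [he]; fun_prop
  have hconst : ‖fourierHat f η‖ₑ ≤ ‖∫ v, e v * (f v : ℂ)‖ₑ := by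
    rw [fourierHat, enorm_mul]
    refine mul_le_of_le_one_left zero_le ?_
    rw [← ofReal_norm, Complex.norm_real, ENNReal.ofReal_le_one,
      Real.norm_of_nonneg (by positivity)]
    refine Real.rpow_le_one_of_one_le_of_nonpos ?_ (by norm_num)
    nlinarith [Real.pi_gt_three]
  refine hconst.trans ?_
  -- Without integrability the integral is `0` by convention and the bound is trivial. With it,
  -- Fubini applies because `∫ |F v r| dr = |f v|`.
  by_cases hi : Integrable fun v => e v * (f v : ℂ)
  swap; · rw [integral_undef hi]; simp
  have hr : ∀ v : E3, IntegrableOn (fun r : ℝ => Real.exp (-(1 + ‖v‖ ^ 2) * r)) (Set.Ioi 0) :=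
    fun v => integrableOn_exp_mul_Ioi (by nlinarith [sq_nonneg ‖v‖]) 0
  have hri : ∀ v : E3, ∫ r in Set.Ioi (0 : ℝ), Real.exp (-(1 + ‖v‖ ^ 2) * r) =
      (1 + ‖v‖ ^ 2)⁻¹ := fun v => by
    rw [integral_exp_mul_Ioi (by nlinarith [sq_nonneg ‖v‖])]
    rw [mul_zero, Real.exp_zero, neg_div_neg_eq, one_div]
  set F : E3 → ℝ → ℂ := fun v r => e v * (g v * (Real.exp (-(1 + ‖v‖ ^ 2) * r) : ℂ)) with hF
  have hFi : ∀ v, ∫ r in Set.Ioi (0 : ℝ), F v r = e v * (f v : ℂ) := fun v => by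
    simp only [hF]
    rw [integral_const_mul, integral_const_mul, integral_complex_ofReal, hri]
    have : (1 + ‖v‖ ^ 2) ≠ 0 := by positivity
    have h2 : (g v) * (((1 + ‖v‖ ^ 2)⁻¹ : ℝ) : ℂ) = (f v : ℂ) := by
      simp only [hgdef]
      rw [← Complex.ofReal_mul]
      congr 1
      field_simp
    rw [← h2]
  have hFint : Integrable (Function.uncurry F) (volume.prod (volume.restrict (Set.Ioi (0 : ℝ)))) := by
    have hm : AEStronglyMeasurable (Function.uncurry F)
        (volume.prod (volume.restrict (Set.Ioi (0 : ℝ)))) := by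
      refine AEStronglyMeasurable.mul (hec.aestronglyMeasurable.comp_fst)
        (AEStronglyMeasurable.mul hg.1.comp_fst (Continuous.aestronglyMeasurable ?_))
      fun_prop
    rw [integrable_prod_iff hm]
    refine ⟨Filter.Eventually.of_forall fun v => ?_, ?_⟩
    · have : IntegrableOn (fun r : ℝ => ((Real.exp (-(1 + ‖v‖ ^ 2) * r) : ℝ) : ℂ)) (Set.Ioi 0) :=
        (hr v).ofReal
      exact (this.const_mul (g v)).const_mul (e v)
    · refine hi.norm.congr (Filter.Eventually.of_forall fun v => ?_)
      have : ∀ r, ‖Function.uncurry F (v, r)‖ = ‖g v‖ * Real.exp (-(1 + ‖v‖ ^ 2) * r) := fun r => by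
        simp only [Function.uncurry, hF, norm_mul, hen, one_mul, Complex.norm_real, Real.norm_eq_abs,
          Real.abs_exp]
      simp only [this]
      rw [integral_const_mul, hri, norm_mul, hen, one_mul, hgdef]
      simp only
      rw [Complex.norm_real, Complex.norm_real, norm_mul,
        Real.norm_of_nonneg (show 0 ≤ 1 + ‖v‖ ^ 2 by positivity)]
      have : (1 + ‖v‖ ^ 2) ≠ 0 := by positivity
      field_simp
  have hswap : ∫ v, e v * (f v : ℂ) = ∫ r in Set.Ioi (0 : ℝ), ∫ v, F v r := by
    rw [← integral_integral_swap hFint]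
    simp only [hFi]
  rw [hswap]
  refine (enorm_integral_le_lintegral_enorm _).trans (setLIntegral_mono' measurableSet_Ioi ?_)
  intro r hr0
  have h5 : ∫ v, F v r = (Real.exp (-r) : ℂ) *
      ∫ v, e v * (g v * (Real.exp (-r * ‖v‖ ^ 2) : ℂ)) := by
    rw [← integral_const_mul]
    refine integral_congr_ae (Filter.Eventually.of_forall fun v => ?_)
    simp only [hF]
    rw [show -(1 + ‖v‖ ^ 2) * r = -r + -r * ‖v‖ ^ 2 by ring, Real.exp_add, Complex.ofReal_mul]
    ring
  rw [h5, enorm_mul, ← ofReal_norm (Complex.ofReal _), Complex.norm_real,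
    Real.norm_of_nonneg (Real.exp_pos _).le]
  gcongr
  exact enorm_integral_gaussian_mul_le hg hr0 η

/-! ### Heat kernel bounds and the trace estimate on rays. -/

section HeatKernel

theorem lintegral_heatKernel_space {r : ℝ} (hr : 0 < r) (y : E3) :
    ∫⁻ ξ : E3, ENNReal.ofReal ((Real.pi / r) ^ (3 / 2 : ℝ) *
      Real.exp (-‖y - (2 * Real.pi) • ξ‖ ^ 2 / (8 * r))) = ENNReal.ofReal (2 ^ (3 / 2 : ℝ)) := by
  have h1 : ∀ ξ : E3, y - (2 * Real.pi) • ξ = (2 * Real.pi) • ((2 * Real.pi)⁻¹ • y - ξ) :=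
    fun ξ => by rw [smul_sub, smul_inv_smul₀ (by positivity)]
  have h2 : ∀ ξ : E3, -‖(2 * Real.pi) • ξ‖ ^ 2 / (8 * r) = -(Real.pi ^ 2 / (2 * r)) * ‖ξ‖ ^ 2 :=
    fun ξ => by
      rw [norm_smul, Real.norm_of_nonneg (by positivity)]
      field_simp
      ring
  have hb : 0 < Real.pi ^ 2 / (2 * r) := by positivity
  simp only [h1]
  rw [lintegral_sub_left_eq_self (fun ξ : E3 => ENNReal.ofReal ((Real.pi / r) ^ (3 / 2 : ℝ) *
    Real.exp (-‖(2 * Real.pi) • ξ‖ ^ 2 / (8 * r))))]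
  simp only [h2]
  rw [← ofReal_integral_eq_lintegral_ofReal ((integrable_gaussian hb).const_mul _)
    (Filter.Eventually.of_forall fun ξ => by positivity), integral_const_mul,
    GaussianFourier.integral_rexp_neg_mul_sq_norm hb]
  congr 1
  rw [show (Module.finrank ℝ E3 / 2 : ℝ) = 3 / 2 by simp,
    ← Real.mul_rpow (by positivity) (by positivity)]
  congr 1
  field_simp

/-- Only the component along `ω` is kept: `|tω - y| ≥ |t - ω·y|`. The one-dimensional Gaussian
integral is of order `r^{1/2}`, against the normalization `r^{-3/2}`. -/
theorem lintegral_heatKernel_ray_le {r : ℝ} (hr : 0 < r) {ω : E3} (hω : ‖ω‖ = 1) (y : E3) :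
    ∫⁻ t in Set.Ioi (0 : ℝ), ENNReal.ofReal ((Real.pi / r) ^ (3 / 2 : ℝ) *
      Real.exp (-‖t • ω - y‖ ^ 2 / (8 * r))) ≤ ENNReal.ofReal (√8 * Real.pi ^ 2 / r) := by
  set a : ℝ := inner ℝ ω y with ha
  have hb : 0 < (8 * r)⁻¹ := by positivity
  have h1 : ∀ t : ℝ, (t - a) ^ 2 ≤ ‖t • ω - y‖ ^ 2 := fun t => by
    have h := abs_real_inner_le_norm ω (t • ω - y)
    rw [inner_sub_right, inner_smul_right, real_inner_self_eq_norm_sq, hω, ← ha, one_mul, one_pow,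
      mul_one] at h
    rw [← sq_abs]
    gcongr
  calc ∫⁻ t in Set.Ioi (0 : ℝ), ENNReal.ofReal ((Real.pi / r) ^ (3 / 2 : ℝ) *
        Real.exp (-‖t • ω - y‖ ^ 2 / (8 * r)))
      ≤ ∫⁻ t, ENNReal.ofReal ((Real.pi / r) ^ (3 / 2 : ℝ) * Real.exp (-(8 * r)⁻¹ * (t - a) ^ 2)) := by
        refine (setLIntegral_le_lintegral _ _).trans (lintegral_mono fun t => ?_)
        refine ENNReal.ofReal_le_ofReal ?_
        gcongr
        rw [div_eq_inv_mul, neg_mul, mul_neg]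
        exact neg_le_neg (mul_le_mul_of_nonneg_left (h1 t) hb.le)
    _ = ENNReal.ofReal ((Real.pi / r) ^ (3 / 2 : ℝ) * √(Real.pi / (8 * r)⁻¹)) := by
        rw [lintegral_sub_right_eq_self (fun t => ENNReal.ofReal ((Real.pi / r) ^ (3 / 2 : ℝ) *
          Real.exp (-(8 * r)⁻¹ * t ^ 2))), ← ofReal_integral_eq_lintegral_ofReal
          ((integrable_exp_neg_mul_sq hb).const_mul _)
          (Filter.Eventually.of_forall fun ξ => by positivity), integral_const_mul, integral_gaussian]
    _ ≤ _ := by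
        refine ENNReal.ofReal_le_ofReal (le_of_eq ?_)
        rw [show (3 / 2 : ℝ) = 1 + 1 / 2 by norm_num, Real.rpow_add (by positivity), Real.rpow_one,
          ← Real.sqrt_eq_rpow, mul_assoc, ← Real.sqrt_mul (by positivity),
          show Real.pi / r * (Real.pi / (8 * r)⁻¹) = 8 * Real.pi ^ 2 by field_simp,
          Real.sqrt_mul (by norm_num), Real.sqrt_sq Real.pi_pos.le]
        ring

/-- Schur's test. -/
theorem sq_lintegral_lintegral_mul_le {α β : Type*} [MeasurableSpace α] [MeasurableSpace β]
    {μ : Measure α} {ν : Measure β} [SFinite μ] [SFinite ν] {Φ : α × β → ℝ≥0∞} {p : α → ℝ≥0∞}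
    {G : β → ℝ≥0∞} (hΦ : Measurable Φ) (hp : Measurable p) (hG : Measurable G) {a b : ℝ≥0∞}
    (ha : ∀ x, ∫⁻ y, Φ (x, y) ∂ν ≤ a) (hb : ∀ y, ∫⁻ x, Φ (x, y) ∂μ ≤ b) :
    (∫⁻ x, ∫⁻ y, Φ (x, y) * (p x * G y) ∂ν ∂μ) ^ 2 ≤
      (a * ∫⁻ x, p x ^ 2 ∂μ) * (b * ∫⁻ y, G y ^ 2 ∂ν) := by
  have h1 : ∫⁻ x, ∫⁻ y, Φ (x, y) * (p x * G y) ∂ν ∂μ =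
      ∫⁻ z, Φ z * (p z.1 * G z.2) ∂(μ.prod ν) := by
    rw [lintegral_prod _ (by fun_prop)]
  have h2 : ∫⁻ z, Φ z * p z.1 ^ 2 ∂(μ.prod ν) ≤ a * ∫⁻ x, p x ^ 2 ∂μ := by
    rw [lintegral_prod _ (by fun_prop), ← lintegral_const_mul _ (by fun_prop)]
    refine lintegral_mono fun x => ?_
    dsimp only
    rw [lintegral_mul_const _ (by fun_prop)]
    exact mul_le_mul_left (ha x) _
  have h3 : ∫⁻ z, Φ z * G z.2 ^ 2 ∂(μ.prod ν) ≤ b * ∫⁻ y, G y ^ 2 ∂ν := by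
    rw [lintegral_prod_symm _ (by fun_prop), ← lintegral_const_mul _ (by fun_prop)]
    refine lintegral_mono fun y => ?_
    dsimp only
    rw [lintegral_mul_const _ (by fun_prop)]
    exact mul_le_mul_left (hb y) _
  rw [h1]
  exact (sq_lintegral_mul_mul_le hΦ.aemeasurable (by fun_prop) (by fun_prop)).trans
    (mul_le_mul' h2 h3)

/-- An `L²` bound for the integral of a heat evolution against a density on a ray. -/
theorem lintegral_heatKernel_mul_le {r : ℝ} (hr : 0 < r) {ω : E3} (hω : ‖ω‖ = 1)
    {p : ℝ → ℝ≥0∞} {G : E3 → ℝ≥0∞} (hp : Measurable p) (hG : Measurable G) {P Q : ℝ≥0∞}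
    (hP : ∫⁻ t in Set.Ioi (0 : ℝ), p t ^ 2 ≤ P ^ 2) (hQ : ∫⁻ ξ, G ξ ^ 2 ≤ Q ^ 2) :
    ∫⁻ t in Set.Ioi (0 : ℝ), ∫⁻ ξ, ENNReal.ofReal ((Real.pi / r) ^ (3 / 2 : ℝ) *
      Real.exp (-‖t • ω - (2 * Real.pi) • ξ‖ ^ 2 / (8 * r))) * (p t * G ξ) ≤
      ENNReal.ofReal (√(2 ^ (3 / 2 : ℝ) * (√8 * Real.pi ^ 2)) * r ^ (-(1 / 2) : ℝ)) * (P * Q) := by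
  obtain ⟨Φ, hΦm, hΦ⟩ : ∃ Φ : ℝ × E3 → ℝ≥0∞, Measurable Φ ∧
      ∀ t ξ, Φ (t, ξ) = ENNReal.ofReal ((Real.pi / r) ^ (3 / 2 : ℝ) *
        Real.exp (-‖t • ω - (2 * Real.pi) • ξ‖ ^ 2 / (8 * r))) :=
    ⟨fun z => ENNReal.ofReal ((Real.pi / r) ^ (3 / 2 : ℝ) *
        Real.exp (-‖z.1 • ω - (2 * Real.pi) • z.2‖ ^ 2 / (8 * r))),
      ENNReal.measurable_ofReal.comp (Continuous.measurable (by fun_prop)), fun _ _ => rfl⟩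
  have hΦ1 : ∀ t, ∫⁻ ξ, Φ (t, ξ) ≤ ENNReal.ofReal (2 ^ (3 / 2 : ℝ)) := fun t => by
    simp only [hΦ]
    exact (lintegral_heatKernel_space hr (t • ω)).le
  have hΦ2 : ∀ ξ, ∫⁻ t in Set.Ioi (0 : ℝ), Φ (t, ξ) ≤ ENNReal.ofReal (√8 * Real.pi ^ 2 / r) :=
    fun ξ => by
      simp only [hΦ]
      exact lintegral_heatKernel_ray_le hr hω _
  simp only [← hΦ]
  -- The two marginals are `O(1)` in `ξ` and `O(1/r)` in `t`; their geometric mean is the factor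
  -- `r^{-1/2}`.
  have h4 := sq_lintegral_lintegral_mul_le hΦm hp hG hΦ1 hΦ2
  refine (ENNReal.pow_le_pow_left_iff two_ne_zero).1 (h4.trans ((mul_le_mul'
    (mul_le_mul_right hP _) (mul_le_mul_right hQ _)).trans_eq ?_))
  have hc : 0 ≤ (2 : ℝ) ^ (3 / 2 : ℝ) := by positivity
  have h5 : (√(2 ^ (3 / 2 : ℝ) * (√8 * Real.pi ^ 2)) * r ^ (-(1 / 2) : ℝ)) ^ 2 =
      2 ^ (3 / 2 : ℝ) * (√8 * Real.pi ^ 2 / r) := by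
    rw [mul_pow, Real.sq_sqrt (by positivity), ← Real.rpow_natCast (r ^ _), ← Real.rpow_mul hr.le,
      show -(1 / 2) * ((2 : ℕ) : ℝ) = -1 by norm_num, Real.rpow_neg_one]
    ring
  rw [mul_pow, ← ENNReal.ofReal_pow (by positivity), h5, ENNReal.ofReal_mul hc]
  ring

end HeatKernel

/-- Moves the weight from the ray to the density: `1 + t ≤ (1 + x)(1 + y)`, and `(1 + y)^σ ≲
e^{y/2}` is absorbed by half of each exponent, as `y/2 ≤ r/2 + y²/(8r)`. -/
theorem exists_exp_le_weight {σ : ℝ} (hσ : 0 ≤ σ) : ∃ D : ℝ, 0 ≤ D ∧ ∀ t x y r : ℝ, 0 ≤ t → 0 ≤ x →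
    0 ≤ y → t ≤ x + y → 0 < r → Real.exp (-r) * Real.exp (-y ^ 2 / (4 * r)) ≤
      D * (1 + t) ^ (-σ) * (1 + x ^ 2) ^ (σ / 2) * Real.exp (-r / 2) * Real.exp (-y ^ 2 / (8 * r)) := by
  -- From `1 + y ≤ m e^{y/m}` the power `σ` gives the exponent `σy/m ≤ y/2`; the first inequality
  -- needs `m ≥ 1`.
  set m : ℝ := max (2 * σ) 1 with hm
  have hm1 : 1 ≤ m := le_max_right _ _
  have hm0 : 0 < m := by linarith
  refine ⟨2 ^ (σ / 2) * m ^ σ, by positivity, fun t x y r ht hx hy htxy hr => ?_⟩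
  have h1 : (1 + t) ^ σ ≤ (1 + x) ^ σ * (1 + y) ^ σ := by
    rw [← Real.mul_rpow (by positivity) (by positivity)]
    refine Real.rpow_le_rpow (by positivity) ?_ hσ
    nlinarith [mul_nonneg hx hy]
  have h2 : (1 + x) ^ σ ≤ 2 ^ (σ / 2) * (1 + x ^ 2) ^ (σ / 2) := by
    rw [← Real.mul_rpow (by positivity) (by positivity),
      show (1 + x) ^ σ = ((1 + x) ^ (2 : ℝ)) ^ (σ / 2) by
        rw [← Real.rpow_mul (by positivity)]; ring_nf]
    refine Real.rpow_le_rpow (by positivity) ?_ (by positivity)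
    rw [Real.rpow_two]
    nlinarith [sq_nonneg (x - 1)]
  have h3 : (1 + y) ^ σ ≤ m ^ σ * Real.exp (y / 2) := by
    have h4 : 1 + y ≤ m * Real.exp (y / m) := by
      have h5 := Real.add_one_le_exp (y / m)
      calc 1 + y ≤ m * (y / m + 1) := by rw [mul_add, mul_div_cancel₀ _ hm0.ne']; linarith
        _ ≤ _ := by gcongr
    calc (1 + y) ^ σ ≤ (m * Real.exp (y / m)) ^ σ := Real.rpow_le_rpow (by positivity) h4 hσ
      _ = m ^ σ * Real.exp (y / m * σ) := by
        rw [Real.mul_rpow hm0.le (Real.exp_pos _).le, ← Real.exp_mul]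
      _ ≤ _ := by
        gcongr
        rw [div_mul_eq_mul_div, div_le_div_iff₀ hm0 two_pos]
        have := le_max_left (2 * σ) 1
        nlinarith
  have h6 : Real.exp (y / 2) * Real.exp (-r) * Real.exp (-y ^ 2 / (4 * r)) ≤
      Real.exp (-r / 2) * Real.exp (-y ^ 2 / (8 * r)) := by
    rw [← Real.exp_add, ← Real.exp_add, ← Real.exp_add]
    refine Real.exp_le_exp.2 ?_
    have : -r / 2 + -y ^ 2 / (8 * r) - (y / 2 + -r + -y ^ 2 / (4 * r)) =
        (2 * r - y) ^ 2 / (8 * r) := by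
      field_simp; ring
    have h7 : 0 ≤ (2 * r - y) ^ 2 / (8 * r) := by positivity
    linarith
  have h8 : (1 + t) ^ (-σ) * (1 + t) ^ σ = 1 := by
    rw [← Real.rpow_add (by positivity)]; simp
  calc Real.exp (-r) * Real.exp (-y ^ 2 / (4 * r))
      = (1 + t) ^ (-σ) * (1 + t) ^ σ * (Real.exp (-r) * Real.exp (-y ^ 2 / (4 * r))) := by
        rw [h8, one_mul]
    _ ≤ (1 + t) ^ (-σ) * ((2 ^ (σ / 2) * (1 + x ^ 2) ^ (σ / 2)) * (m ^ σ * Real.exp (y / 2))) *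
        (Real.exp (-r) * Real.exp (-y ^ 2 / (4 * r))) := by
        gcongr
        exact h1.trans (mul_le_mul h2 h3 (by positivity) (by positivity))
    _ = (1 + t) ^ (-σ) * (2 ^ (σ / 2) * (1 + x ^ 2) ^ (σ / 2)) * m ^ σ *
        (Real.exp (y / 2) * Real.exp (-r) * Real.exp (-y ^ 2 / (4 * r))) := by ring
    _ ≤ (1 + t) ^ (-σ) * (2 ^ (σ / 2) * (1 + x ^ 2) ^ (σ / 2)) * m ^ σ *
        (Real.exp (-r / 2) * Real.exp (-y ^ 2 / (8 * r))) := by gcongr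
    _ = _ := by ring

/-- The Fourier transform of `f` is integrable along rays, with a polynomial weight: a trace
theorem for `H^σ_M`. -/
theorem lintegral_fourierHat_ray_le (s : ℕ) {σ : ℝ} (hσ : (s : ℝ) + 3 / 2 < σ) :
    ∃ C : ℝ≥0, ∀ (f : E3 → ℝ) (M : ℕ) (C₀ : ℝ) (ω : E3), 2 ≤ M →
      weightedSobolevNorm σ M f ≤ ENNReal.ofReal C₀ → ‖ω‖ = 1 →
      ∫⁻ t in Set.Ioi (0 : ℝ), ENNReal.ofReal ((1 + t) ^ s * t) * ‖fourierHat f (t • ω)‖ₑ ≤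
        C * ENNReal.ofReal C₀ := by
  have hσ0 : 0 ≤ σ := by linarith [(Nat.cast_nonneg s : (0 : ℝ) ≤ s)]
  obtain ⟨D, hD0, hD⟩ := exists_exp_le_weight hσ0
  set p : ℝ → ℝ≥0∞ := fun t => ENNReal.ofReal ((1 + t) ^ s * t * (1 + t) ^ (-σ)) with hp
  have hpm : Measurable p := by fun_prop
  -- `p² ≤ (1 + t)^{-2(σ-s-1)}`, and `2(σ - s - 1) > 1` is exactly the condition `σ > s + 3/2`.
  have hpfin : ∫⁻ t in Set.Ioi (0 : ℝ), p t ^ 2 < ∞ := by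
    have h1 := finite_integral_one_add_norm (E := ℝ) (μ := volume) (r := 2 * (σ - s - 1))
      (by simp; linarith)
    refine lt_of_le_of_lt ?_ h1
    refine (setLIntegral_mono' measurableSet_Ioi fun t ht => ?_).trans (setLIntegral_le_lintegral _ _)
    have ht0 : 0 < t := ht
    simp only [hp]
    rw [← ENNReal.ofReal_pow (by positivity), Real.norm_of_nonneg ht0.le]
    refine ENNReal.ofReal_le_ofReal ?_
    calc ((1 + t) ^ s * t * (1 + t) ^ (-σ)) ^ 2
        ≤ ((1 + t) ^ s * (1 + t) * (1 + t) ^ (-σ)) ^ 2 := by gcongr; linarith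
      _ = (1 + t) ^ (-(2 * (σ - s - 1))) := by
        have hpos : 0 < 1 + t := by linarith
        rw [← pow_succ, ← Real.rpow_natCast, ← Real.rpow_natCast, ← Real.rpow_add hpos,
          ← Real.rpow_mul hpos.le]
        congr 1
        push_cast
        ring
  set c : ℝ := √(2 ^ (3 / 2 : ℝ) * (√8 * Real.pi ^ 2)) with hc
  set J : ℝ≥0∞ := ∫⁻ r in Set.Ioi (0 : ℝ), ENNReal.ofReal (D * Real.exp (-r / 2)) *
    ENNReal.ofReal (c * r ^ (-(1 / 2) : ℝ)) with hJ
  have hJfin : J < ∞ := by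
    have h1 := (integrableOn_rpow_mul_exp_neg_mul_rpow (p := 1) (s := -(1 / 2)) (b := 1 / 2)
      (by norm_num) one_pos (by norm_num)).const_mul (D * c)
    refine lt_of_le_of_lt (setLIntegral_mono' measurableSet_Ioi fun r hr => ?_) h1.2
    have hr0 : 0 < r := hr
    rw [← ENNReal.ofReal_mul (by positivity), ← ofReal_norm, Real.norm_of_nonneg (by positivity)]
    refine ENNReal.ofReal_le_ofReal (le_of_eq ?_)
    simp only [Real.rpow_one]
    rw [show -(1 / 2 : ℝ) * r = -r / 2 by ring]
    ring
  set P : ℝ≥0∞ := (∫⁻ t in Set.Ioi (0 : ℝ), p t ^ 2) ^ (1 / 2 : ℝ) with hPdef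
  have hP : ∫⁻ t in Set.Ioi (0 : ℝ), p t ^ 2 ≤ P ^ 2 := by
    rw [hPdef, ← ENNReal.rpow_two, ← ENNReal.rpow_mul]
    norm_num
  have hPfin : P < ∞ := ENNReal.rpow_lt_top_of_nonneg (by norm_num) hpfin.ne
  refine ⟨(J * P).toNNReal, fun f M C₀ ω hM hf hω => ?_⟩
  rw [ENNReal.coe_toNNReal (ENNReal.mul_lt_top hJfin hPfin).ne]
  have hsob := (sobolevNorm_one_add_sq_mul_le σ hM f).trans hf
  have hg := memLp_of_sobolevNorm_lt_top (hsob.trans_lt ENNReal.ofReal_lt_top)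
  rw [sobolevNorm_of_memLp hg] at hsob
  set Fg : E3 → ℂ := ⇑(𝓕 (hg.toLp _) : Lp ℂ 2 (volume : Measure E3)) with hFg
  have hFgm : Measurable Fg := (Lp.stronglyMeasurable _).measurable
  set G : E3 → ℝ≥0∞ := fun ξ =>
    ‖(((1 + ‖(2 * Real.pi) • ξ‖ ^ 2) ^ (σ / 2) : ℝ) : ℂ) * Fg ξ‖ₑ with hG
  have hGm : Measurable G := by
    refine Measurable.enorm (Measurable.mul ?_ hFgm)
    exact (Complex.continuous_ofReal.comp (continuous_sobolevWeight σ)).measurable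
  have hQ : ∫⁻ ξ, G ξ ^ 2 ≤ ENNReal.ofReal C₀ ^ 2 := by
    rw [hG, ← eLpNorm_two_sq]
    gcongr
  set h : ℝ → ℝ → ℝ≥0∞ := fun t r => ENNReal.ofReal (D * Real.exp (-r / 2)) *
    ∫⁻ ξ, ENNReal.ofReal ((Real.pi / r) ^ (3 / 2 : ℝ) *
      Real.exp (-‖t • ω - (2 * Real.pi) • ξ‖ ^ 2 / (8 * r))) * (p t * G ξ) with hh
  have hhm : Measurable (Function.uncurry h) := by
    refine Measurable.mul (by fun_prop) ?_
    refine Measurable.lintegral_prod_right' (f := fun z : (ℝ × ℝ) × E3 =>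
      ENNReal.ofReal ((Real.pi / z.1.2) ^ (3 / 2 : ℝ) *
      Real.exp (-‖z.1.1 • ω - (2 * Real.pi) • z.2‖ ^ 2 / (8 * z.1.2))) * (p z.1.1 * G z.2)) ?_
    fun_prop
  calc ∫⁻ t in Set.Ioi (0 : ℝ), ENNReal.ofReal ((1 + t) ^ s * t) * ‖fourierHat f (t • ω)‖ₑ
      ≤ ∫⁻ t in Set.Ioi (0 : ℝ), ∫⁻ r in Set.Ioi (0 : ℝ), h t r := by
        refine setLIntegral_mono' measurableSet_Ioi fun t ht => ?_
        have ht0 : 0 < t := ht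
        refine (mul_le_mul_right (enorm_fourierHat_le hg (t • ω)) _).trans ?_
        rw [← lintegral_const_mul' _ _ ENNReal.ofReal_ne_top]
        refine setLIntegral_mono' measurableSet_Ioi fun r hr => ?_
        have hr0 : 0 < r := hr
        simp only [hh]
        rw [← lintegral_const_mul' _ _ ENNReal.ofReal_ne_top,
          ← lintegral_const_mul' _ _ ENNReal.ofReal_ne_top,
          ← lintegral_const_mul' _ _ ENNReal.ofReal_ne_top]
        refine lintegral_mono fun ξ => ?_
        set y := ‖t • ω - (2 * Real.pi) • ξ‖ with hy
        set x := ‖(2 * Real.pi) • ξ‖ with hx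
        have htxy : t ≤ x + y := by
          have h1 : ‖t • ω‖ = t := by rw [norm_smul, hω, mul_one, Real.norm_of_nonneg ht0.le]
          calc t = ‖(2 * Real.pi) • ξ + (t • ω - (2 * Real.pi) • ξ)‖ := by
                rw [add_sub_cancel, h1]
            _ ≤ x + y := norm_add_le _ _
        have key := hD t x y r ht0.le (norm_nonneg _) (norm_nonneg _) htxy hr0
        simp only [hG, hp]
        rw [enorm_mul, ← ofReal_norm (Complex.ofReal _), Complex.norm_real,
          Real.norm_of_nonneg (by positivity)]
        set α := (Real.pi / r) ^ (3 / 2 : ℝ) with hα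
        have hα0 : 0 ≤ α := by positivity
        have e1 : ∀ {a b c : ℝ} {z : ℝ≥0∞}, 0 ≤ a → 0 ≤ b → ENNReal.ofReal a * (ENNReal.ofReal b *
            (z * ENNReal.ofReal c)) = ENNReal.ofReal (a * b * c) * z := fun ha hb => by
          rw [ENNReal.ofReal_mul (mul_nonneg ha hb), ENNReal.ofReal_mul ha]
          ring
        have e2 : ∀ {a b c d : ℝ} {z : ℝ≥0∞}, 0 ≤ a → 0 ≤ b → 0 ≤ c → ENNReal.ofReal a *
            (ENNReal.ofReal b * (ENNReal.ofReal c * (ENNReal.ofReal d * z))) =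
            ENNReal.ofReal (a * b * c * d) * z := fun ha hb hc => by
          rw [ENNReal.ofReal_mul (mul_nonneg (mul_nonneg ha hb) hc),
            ENNReal.ofReal_mul (mul_nonneg ha hb), ENNReal.ofReal_mul ha]
          ring
        rw [e1 (by positivity) (by positivity), e2 (by positivity) (by positivity) (by positivity)]
        refine mul_le_mul' (ENNReal.ofReal_le_ofReal ?_) le_rfl
        calc (1 + t) ^ s * t * Real.exp (-r) * (α * Real.exp (-y ^ 2 / (4 * r)))
            = (1 + t) ^ s * t * α * (Real.exp (-r) * Real.exp (-y ^ 2 / (4 * r))) := by ring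
          _ ≤ (1 + t) ^ s * t * α * (D * (1 + t) ^ (-σ) * (1 + x ^ 2) ^ (σ / 2) *
              Real.exp (-r / 2) * Real.exp (-y ^ 2 / (8 * r))) := by gcongr
          _ = _ := by ring
    _ = ∫⁻ r in Set.Ioi (0 : ℝ), ∫⁻ t in Set.Ioi (0 : ℝ), h t r :=
        lintegral_lintegral_swap hhm.aemeasurable
    _ ≤ ∫⁻ r in Set.Ioi (0 : ℝ), ENNReal.ofReal (D * Real.exp (-r / 2)) *
          ENNReal.ofReal (c * r ^ (-(1 / 2) : ℝ)) * (P * ENNReal.ofReal C₀) := by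
        refine setLIntegral_mono' measurableSet_Ioi fun r hr => ?_
        simp only [hh]
        rw [lintegral_const_mul' _ _ ENNReal.ofReal_ne_top, mul_assoc]
        gcongr
        exact lintegral_heatKernel_mul_le hr hω hpm hGm hP hQ
    _ = J * P * ENNReal.ofReal C₀ := by
        rw [lintegral_mul_const' _ _ (ENNReal.mul_lt_top hPfin ENNReal.ofReal_lt_top).ne, mul_assoc]

/-! ### The kernel `K⁰` at a fixed frequency. -/

section Kernel

/-- The kernel at the frequency `k`, extended by zero to negative times. -/
noncomputable def causalKernel (W f₀ : E3 → ℝ) (k : E3) : ℝ → ℂ :=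
  (Set.Ioi (0 : ℝ)).indicator fun t => kernel W f₀ t k

variable {W f₀ : E3 → ℝ} {k : E3}

theorem causalKernel_of_nonpos {t : ℝ} (ht : t ≤ 0) : causalKernel W f₀ k t = 0 :=
  Set.indicator_of_notMem (by simpa using ht) _

theorem enorm_fourierHat_le_integral (W : E3 → ℝ) (k : E3) :
    ‖fourierHat W k‖ₑ ≤ ENNReal.ofReal (∫ x, |W x|) := by
  have hc : (2 * Real.pi) ^ (-(3 / 2) : ℝ) ≤ 1 :=
    Real.rpow_le_one_of_one_le_of_nonpos (by nlinarith [Real.pi_gt_three]) (by norm_num)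
  rw [← ofReal_norm]
  refine ENNReal.ofReal_le_ofReal ?_
  rw [fourierHat, norm_mul, Complex.norm_real, Real.norm_of_nonneg (by positivity)]
  refine (mul_le_of_le_one_left (norm_nonneg _) hc).trans
    ((norm_integral_le_integral_norm _).trans_eq (integral_congr_ae (Eventually.of_forall fun v => ?_)))
  simp [Complex.norm_exp]

theorem aestronglyMeasurable_fourierHat_smul (hf : AEStronglyMeasurable fun v => (f₀ v : ℂ)) (k : E3) :
    AEStronglyMeasurable fun t : ℝ => fourierHat f₀ (t • k) := by
  have : AEStronglyMeasurable (fun z : ℝ × E3 =>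
      Complex.exp (-(Complex.I * ((inner ℝ z.2 (z.1 • k) : ℝ) : ℂ))) * (f₀ z.2 : ℂ))
      (volume.prod volume) :=
    AEStronglyMeasurable.mul (Continuous.aestronglyMeasurable (by fun_prop)) hf.comp_snd
  exact this.integral_prod_right'.const_mul _

theorem aestronglyMeasurable_causalKernel (hf : AEStronglyMeasurable fun v => (f₀ v : ℂ)) :
    AEStronglyMeasurable (causalKernel W f₀ k) := by
  refine AEStronglyMeasurable.indicator ?_ measurableSet_Ioi
  refine (((aestronglyMeasurable_fourierHat_smul hf k).mul_const _).mul
    (Continuous.aestronglyMeasurable ?_)).neg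
  fun_prop

theorem lintegral_Ioi_comp_mul_left (q : ℝ → ℝ≥0∞) {a : ℝ} (ha : 0 < a) :
    ENNReal.ofReal a * ∫⁻ t in Set.Ioi (0 : ℝ), q (a * t) = ∫⁻ t in Set.Ioi (0 : ℝ), q t := by
  have h1 : ∀ t, (Set.Ioi (0 : ℝ)).indicator (fun t => q (a * t)) t =
      (Set.Ioi (0 : ℝ)).indicator q (a * t) := fun t => by
    simp [Set.indicator_apply, ha]
  rw [← lintegral_indicator measurableSet_Ioi, ← lintegral_indicator measurableSet_Ioi]
  simp only [h1]
  rw [← (measurableEmbedding_mulLeft₀ ha.ne').lintegral_map, Real.map_volume_mul_left ha.ne',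
    lintegral_smul_measure, smul_eq_mul, ← mul_assoc, ← ENNReal.ofReal_mul ha.le,
    abs_of_pos (inv_pos.2 ha), mul_inv_cancel₀ ha.ne', ENNReal.ofReal_one, one_mul]

/-- Substitute `t ↦ t/|k|`: in `|k|² t` one factor `|k|` is the Jacobian and the other turns `t`
into `|k|t`. With `μ ≤ |k|` the bound no longer depends on `k`. -/
theorem lintegral_timeWeight_causalKernel_le {μ : ℝ} (hμ : 0 ≤ μ) (hμk : μ ≤ ‖k‖) (s : ℕ)
    {X : ℝ≥0∞} (hX : ∀ ω : E3, ‖ω‖ = 1 → ∫⁻ t in Set.Ioi (0 : ℝ),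
      ENNReal.ofReal ((1 + t) ^ s * t) * ‖fourierHat f₀ (t • ω)‖ₑ ≤ X) :
    ∫⁻ t, ‖timeWeight μ s (causalKernel W f₀ k) t‖ₑ ≤ ENNReal.ofReal (∫ x, |W x|) * X := by
  rcases eq_or_ne k 0 with rfl | hk
  · have : ∀ t, timeWeight μ s (causalKernel W f₀ 0) t = 0 := fun t => by
      simp [timeWeight, causalKernel, kernel]
    simp [this]
  have hl : 0 < ‖k‖ := norm_pos_iff.2 hk
  set ω : E3 := ‖k‖⁻¹ • k with hω
  have hω1 : ‖ω‖ = 1 := by rw [hω, norm_smul, norm_inv, norm_norm, inv_mul_cancel₀ hl.ne']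
  set q : ℝ → ℝ≥0∞ := fun t => ENNReal.ofReal ((1 + t) ^ s * t) * ‖fourierHat f₀ (t • ω)‖ₑ with hq
  calc ∫⁻ t, ‖timeWeight μ s (causalKernel W f₀ k) t‖ₑ
      ≤ ∫⁻ t, (Set.Ioi (0 : ℝ)).indicator (fun t => (‖fourierHat W k‖ₑ * ENNReal.ofReal ‖k‖) *
          q (‖k‖ * t)) t := by
        refine lintegral_mono fun t => ?_
        rcases le_or_gt t 0 with ht | ht
        · simp [timeWeight, causalKernel_of_nonpos ht]
        · rw [Set.indicator_of_mem (by exact ht), timeWeight, causalKernel,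
            Set.indicator_of_mem (by exact ht), kernel, hq]
          have h1 : (‖k‖ * t) • ω = t • k := by
            rw [hω, smul_smul, mul_assoc, mul_comm t, ← mul_assoc, mul_inv_cancel₀ hl.ne', one_mul]
          simp only
          rw [h1, enorm_mul, enorm_neg, enorm_mul, enorm_mul, ← ofReal_norm (Complex.ofReal _),
            ← ofReal_norm (Complex.ofReal _), Complex.norm_real, Complex.norm_real,
            Real.norm_of_nonneg (by positivity), Real.norm_of_nonneg (by positivity)]
          calc ENNReal.ofReal ((1 + μ * t) ^ s) * (‖fourierHat f₀ (t • k)‖ₑ * ‖fourierHat W k‖ₑ *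
                ENNReal.ofReal (‖k‖ ^ 2 * t))
              ≤ ENNReal.ofReal ((1 + ‖k‖ * t) ^ s) * (‖fourierHat f₀ (t • k)‖ₑ * ‖fourierHat W k‖ₑ *
                ENNReal.ofReal (‖k‖ ^ 2 * t)) := by gcongr
            _ = _ := by
              rw [ENNReal.ofReal_mul (p := (1 + ‖k‖ * t) ^ s) (by positivity),
                show ‖k‖ ^ 2 * t = ‖k‖ * (‖k‖ * t) by ring, ENNReal.ofReal_mul hl.le]
              ring
    _ = ‖fourierHat W k‖ₑ * (ENNReal.ofReal ‖k‖ * ∫⁻ t in Set.Ioi (0 : ℝ), q (‖k‖ * t)) := by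
        rw [lintegral_indicator measurableSet_Ioi, lintegral_const_mul' _ _
          (ENNReal.mul_ne_top enorm_ne_top ENNReal.ofReal_ne_top), mul_assoc]
    _ = ‖fourierHat W k‖ₑ * ∫⁻ t in Set.Ioi (0 : ℝ), q t := by
        rw [lintegral_Ioi_comp_mul_left q hl]
    _ ≤ _ := mul_le_mul' (enorm_fourierHat_le_integral W k) (hX ω hω1)

/-- The conjugate in `𝓛` turns `-a + 2πiξ` into `-a - 2πiξ`, the exponent of the damped Fourier
integral. For `a ≥ 0` these points fill the closed left half-plane of (L). -/
theorem fourier_damp_causalKernel (a : ℝ≥0) (ξ : ℝ) :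
    𝓕 (damp a (causalKernel W f₀ k)) ξ =
      dispersion W f₀ (-(a : ℂ) + 2 * Real.pi * ξ * Complex.I) k := by
  rw [Real.fourier_real_eq_integral_exp_smul, dispersion, ← integral_indicator measurableSet_Ioi]
  refine integral_congr_ae (Eventually.of_forall fun t => ?_)
  simp only [damp, causalKernel]
  rcases le_or_gt t 0 with ht | ht
  · simp [Set.indicator_of_notMem (show t ∉ Set.Ioi (0 : ℝ) by simpa using ht)]
  · have ht' : t ∈ Set.Ioi (0 : ℝ) := ht
    rw [Set.indicator_of_mem ht', Set.indicator_of_mem ht', smul_eq_mul, Complex.ofReal_exp,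
      ← mul_assoc, ← Complex.exp_add]
    congr 2
    have h2 : conj (2 : ℂ) = 2 := map_ofNat _ 2
    simp [Complex.conj_ofReal, h2]
    ring

theorem le_norm_one_sub_fourier_damp {C₀ κ σ : ℝ} {M : ℕ}
    (h : StabilityCondition W f₀ C₀ κ σ M) (a : ℝ≥0) (ξ : ℝ) :
    κ ≤ ‖1 - 𝓕 (damp a (causalKernel W f₀ k)) ξ‖ := by
  rw [fourier_damp_causalKernel, norm_sub_rev]
  exact h.stable _ (by simp) k

/-- The two cut-offs restrict `τ` to `(0, t)`; the endpoint `τ = t` agrees as well, since the kernel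
vanishes at time `0`. -/
theorem convolution_causalKernel (φ : ℝ → ℂ) {t : ℝ} (ht : 0 < t) :
    (causalKernel W f₀ k ⋆[ContinuousLinearMap.mul ℂ ℂ] (Set.Ioi (0 : ℝ)).indicator φ) t =
      ∫ τ in (0 : ℝ)..t, kernel W f₀ (t - τ) k * φ τ := by
  rw [convolution_eq_swap, intervalIntegral.integral_of_le ht.le,
    ← integral_indicator measurableSet_Ioc]
  refine integral_congr_ae (Eventually.of_forall fun τ => ?_)
  simp only [ContinuousLinearMap.mul_apply', causalKernel, Set.indicator_apply, Set.mem_Ioi,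
    Set.mem_Ioc, sub_pos]
  rcases le_or_gt τ 0 with h | h
  · simp [not_lt.2 h]
  · rcases lt_trichotomy τ t with h' | rfl | h'
    · simp [h, h', h'.le]
    · simp [kernel]
    · simp [h'.le, not_le.2 h']

end Kernel

/-! ### Comparison of `⟨k,kt⟩` with `⟨k⟩ (1 + μt)`. -/

section Weights

theorem sqrt_one_add_sq_le {x : ℝ} (hx : 0 ≤ x) : √(1 + x ^ 2) ≤ 1 + x :=
  Real.sqrt_le_iff.2 ⟨by positivity, by nlinarith⟩

theorem one_add_le_two_mul_sqrt {x : ℝ} : 1 + x ≤ 2 * √(1 + x ^ 2) := by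
  have h1 : 1 ≤ √(1 + x ^ 2) := Real.le_sqrt_of_sq_le (by nlinarith [sq_nonneg x])
  have h2 : x ≤ √(1 + x ^ 2) := Real.le_sqrt_of_sq_le (by linarith)
  linarith

variable {α : ℝ} {s : ℕ} {k : E3} {t : ℝ}

theorem sqrt_weight_eq (k : E3) (t : ℝ) : √(1 + ‖k‖ ^ 2 + ‖t • k‖ ^ 2) =
    √(1 + ‖k‖ ^ 2) * √(1 + (‖k‖ / √(1 + ‖k‖ ^ 2) * t) ^ 2) := by
  rw [← Real.sqrt_mul (by positivity), norm_smul, mul_pow, mul_pow, div_pow,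
    Real.sq_sqrt (by positivity), Real.norm_eq_abs, sq_abs]
  congr 1
  field_simp

theorem norm_weighted_le (u : ℝ → E3 → ℂ) (ht : 0 ≤ t) : ‖weighted α s k u t‖ ≤
    ‖k‖ ^ α * √(1 + ‖k‖ ^ 2) ^ s * ‖timeWeight (‖k‖ / √(1 + ‖k‖ ^ 2)) s (fun t => u t k) t‖ := by
  have hx : 0 ≤ ‖k‖ / √(1 + ‖k‖ ^ 2) * t := by positivity
  rw [weighted, timeWeight, sqrt_weight_eq, norm_mul, norm_mul, Complex.norm_real, Complex.norm_real,
    Real.norm_of_nonneg (by positivity), Real.norm_of_nonneg (by positivity), mul_pow, ← mul_assoc,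
    ← mul_assoc]
  gcongr
  exact sqrt_one_add_sq_le hx

theorem norm_timeWeight_le (u : ℝ → E3 → ℂ) (ht : 0 ≤ t) :
    ‖k‖ ^ α * √(1 + ‖k‖ ^ 2) ^ s * ‖timeWeight (‖k‖ / √(1 + ‖k‖ ^ 2)) s (fun t => u t k) t‖ ≤
      2 ^ s * ‖weighted α s k u t‖ := by
  have hx : 0 ≤ ‖k‖ / √(1 + ‖k‖ ^ 2) * t := by positivity
  rw [weighted, timeWeight, sqrt_weight_eq, norm_mul, norm_mul, Complex.norm_real, Complex.norm_real,
    Real.norm_of_nonneg (by positivity), Real.norm_of_nonneg (by positivity)]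
  set c := √(1 + ‖k‖ ^ 2)
  set x := ‖k‖ / c * t
  calc ‖k‖ ^ α * c ^ s * ((1 + x) ^ s * ‖u t k‖)
      ≤ ‖k‖ ^ α * c ^ s * ((2 * √(1 + x ^ 2)) ^ s * ‖u t k‖) := by
        gcongr
        exact one_add_le_two_mul_sqrt
    _ = _ := by rw [mul_pow, mul_pow]; ring

end Weights

/-! ### Measurability and the final assembly. -/

theorem StabilityCondition.two_le {W f₀ : E3 → ℝ} {C₀ κ σ : ℝ} {M : ℕ}
    (h : StabilityCondition W f₀ C₀ κ σ M) : 2 ≤ M := by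
  by_contra hM
  have h1 : (M : ℝ) ≤ 1 := by exact_mod_cast Nat.le_of_lt_succ (not_le.1 hM)
  linarith [h.M_gt]

/-- Finiteness of the norm puts `(1 + |v|²) f⁰` in `L²`; dividing by the continuous factor recovers
measurability of `f⁰`. -/
theorem StabilityCondition.aestronglyMeasurable {W f₀ : E3 → ℝ} {C₀ κ σ : ℝ} {M : ℕ}
    (h : StabilityCondition W f₀ C₀ κ σ M) : AEStronglyMeasurable fun v => (f₀ v : ℂ) := by
  have hg := memLp_of_sobolevNorm_lt_top (((sobolevNorm_one_add_sq_mul_le σ h.two_le f₀).trans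
    h.norm_le).trans_lt ENNReal.ofReal_lt_top)
  have hc : Continuous fun v : E3 => (((1 + ‖v‖ ^ 2)⁻¹ : ℝ) : ℂ) :=
    Complex.continuous_ofReal.comp (Continuous.inv₀ (by fun_prop) fun v => by positivity)
  refine (hc.aestronglyMeasurable.mul hg.1).congr (Eventually.of_forall fun v => ?_)
  have : (1 + ‖v‖ ^ 2) ≠ 0 := by positivity
  simp only [Pi.mul_apply]
  rw [← Complex.ofReal_mul, inv_mul_cancel_left₀ this]

theorem integrableOn_Iic_indicator {φ : ℝ → ℂ} (hφ : ∀ T : ℝ, IntegrableOn φ (Set.Ioc 0 T)) (T : ℝ) :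
    IntegrableOn ((Set.Ioi (0 : ℝ)).indicator φ) (Set.Iic T) := by
  refine (((integrable_indicator_iff measurableSet_Ioc).2 (hφ T)).integrableOn).congr_fun
    (fun t ht => ?_) measurableSet_Iic
  have ht' : t ≤ T := ht
  simp [Set.indicator_apply, ht']

theorem aestronglyMeasurable_indicator_Ioi {φ : ℝ → ℂ}
    (hφ : ∀ T : ℝ, IntegrableOn φ (Set.Ioc 0 T)) :
    AEStronglyMeasurable ((Set.Ioi (0 : ℝ)).indicator φ) := by
  rw [aestronglyMeasurable_indicator_iff measurableSet_Ioi]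
  have : Set.Ioi (0 : ℝ) = ⋃ n : ℕ, Set.Ioc 0 (n : ℝ) := by
    ext t
    simp only [Set.mem_Ioi, Set.mem_iUnion, Set.mem_Ioc]
    exact ⟨fun h => (exists_nat_ge t).imp fun n hn => ⟨h, hn⟩, fun ⟨_, h, _⟩ => h⟩
  rw [this, aestronglyMeasurable_iUnion_iff]
  exact fun n => (hφ n).1

end LandauDamping

theorem mainTheorem4 (s : ℕ) (σ C₀ κ B : ℝ) (hσ : (s : ℝ) + 3 / 2 < σ) :
    ∃ C : ℝ, 0 < C ∧
      ∀ (W f₀ : LandauDamping.E3 → ℝ) (M : ℕ),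
        LandauDamping.IsPotential W → (∫ x, |W x|) ≤ B →
        LandauDamping.StabilityCondition W f₀ C₀ κ σ M →
        ∀ (α T : ℝ) (k : LandauDamping.E3) (H φ : ℝ → LandauDamping.E3 → ℂ),
          0 < T → (∀ t : ℝ, T < t → H t k = 0) →
          MemLp (LandauDamping.weighted α s k H) 2 (volume.restrict (Set.Ico 0 T)) →
          LandauDamping.IsVolterraSolution W f₀ k H φ →
          MemLp (LandauDamping.weighted α s k φ) 2 (volume.restrict (Set.Ico 0 T)) ∧
          eLpNorm (LandauDamping.weighted α s k φ) 2 (volume.restrict (Set.Ico 0 T)) ≤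
            ENNReal.ofReal C *
              eLpNorm (LandauDamping.weighted α s k H) 2 (volume.restrict (Set.Ico 0 T)) := by
  open LandauDamping Filter in
  rcases le_or_gt κ 0 with hκ | hκ
  · exact ⟨1, one_pos, fun W f₀ M _ _ h => absurd h.κ_pos (not_lt.2 hκ)⟩
  obtain ⟨X, hX⟩ := lintegral_fourierHat_ray_le s hσ
  obtain ⟨C, hC⟩ := volterra_timeWeight (B.toNNReal * (X * C₀.toNNReal)) hκ s
  -- `2^s` is the loss in comparing the weights; `+ 1` only ensures positivity.
  refine ⟨2 ^ s * C + 1, by positivity, ?_⟩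
  intro W f₀ M hW hB hst α T k H φ hT hHT hH hφ
  set c : ℝ := √(1 + ‖k‖ ^ 2) with hc
  have hc1 : 1 ≤ c := Real.le_sqrt_of_sq_le (by nlinarith [sq_nonneg ‖k‖])
  set b : ℝ := ‖k‖ ^ α * c ^ s with hb
  have hb0 : 0 ≤ b := by positivity
  -- `b = 0` means `|k|^α = 0` (the real power at `k = 0`, `α ≠ 0`), and then both weighted
  -- functions vanish identically.
  rcases hb0.eq_or_lt with hbz | hbpos
  · have hz : ∀ u t, weighted α s k u t = 0 := fun u t => by
      have : ‖k‖ ^ α = 0 := by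
        rcases mul_eq_zero.1 hbz.symm with h | h
        · exact h
        · exact absurd h (by positivity)
      simp [weighted, this]
    have hz' : ∀ u, weighted α s k u = 0 := fun u => funext (hz u)
    rw [hz' φ]
    exact ⟨MemLp.zero, by simp⟩
  set μ : ℝ := ‖k‖ / c with hμ
  have hμ0 : 0 ≤ μ := by positivity
  have hμk : μ ≤ ‖k‖ := div_le_self (norm_nonneg _) hc1
  set K := causalKernel W f₀ k with hK
  set Ht : ℝ → ℂ := (Set.Ioi (0 : ℝ)).indicator fun t => H t k with hHt
  set φt : ℝ → ℂ := (Set.Ioi (0 : ℝ)).indicator fun t => φ t k with hφt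
  have hcausal : ∀ u : ℝ → ℂ, ∀ t ≤ 0, (Set.Ioi (0 : ℝ)).indicator u t = 0 :=
    fun u t ht => Set.indicator_of_notMem (by simpa using ht) _
  have hK0 : ∀ t ≤ 0, K t = 0 := fun t ht => causalKernel_of_nonpos ht
  have hKA : ∫⁻ t, ‖timeWeight μ s K t‖ₑ ≤ ((B.toNNReal * (X * C₀.toNNReal) : NNReal) : ℝ≥0∞) := by
    refine (lintegral_timeWeight_causalKernel_le hμ0 hμk s
      (fun ω hω => hX f₀ M C₀ ω hst.two_le hst.norm_le hω)).trans ?_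
    rw [ENNReal.coe_mul, ENNReal.coe_mul]
    exact mul_le_mul' (ENNReal.ofReal_le_ofReal hB) le_rfl
  -- As `H` vanishes after `T`, its norm on `I` controls its norm on the whole line, where the
  -- equation is solved.
  have hHi : Ht =ᵐ[volume] (Set.Ioc 0 T).indicator fun t => H t k := by
    refine Eventually.of_forall fun t => ?_
    rcases le_or_gt t 0 with h | h
    · simp [hHt, not_lt.2 h]
    · rcases le_or_gt t T with h' | h'
      · simp [hHt, h, h']
      · simp [hHt, Set.indicator_apply, h, hHT t h']
  rw [restrict_Ico_eq_restrict_Ioc] at hH ⊢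
  have hHm : AEStronglyMeasurable Ht := by
    refine AEStronglyMeasurable.congr ?_ hHi.symm
    rw [aestronglyMeasurable_indicator_iff measurableSet_Ioc]
    -- Only the weighted `H` is known to be measurable; the weight is continuous and nowhere zero,
    -- so it can be divided out.
    have hkα : ‖k‖ ^ α ≠ 0 := left_ne_zero_of_mul hbpos.ne'
    have hpos : ∀ t : ℝ, ‖k‖ ^ α * √(1 + ‖k‖ ^ 2 + ‖t • k‖ ^ 2) ^ s ≠ 0 := fun t =>
      mul_ne_zero hkα (by positivity)
    have hcont : Continuous fun t : ℝ =>
        (((‖k‖ ^ α * √(1 + ‖k‖ ^ 2 + ‖t • k‖ ^ 2) ^ s)⁻¹ : ℝ) : ℂ) :=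
      Complex.continuous_ofReal.comp (Continuous.inv₀ (by fun_prop) hpos)
    refine (hcont.aestronglyMeasurable.mul hH.1).congr (Eventually.of_forall fun t => ?_)
    simp only [Pi.mul_apply, weighted]
    rw [← mul_assoc, ← Complex.ofReal_mul, inv_mul_cancel₀ (hpos t), Complex.ofReal_one, one_mul]
  have hHle : eLpNorm (timeWeight μ s Ht) 2 volume ≤ ENNReal.ofReal (2 ^ s / b) *
      eLpNorm (weighted α s k H) 2 (volume.restrict (Set.Ioc 0 T)) := by
    rw [← eLpNorm_indicator_eq_eLpNorm_restrict measurableSet_Ioc]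
    refine eLpNorm_le_mul_eLpNorm_of_ae_le_mul ?_ 2
    filter_upwards [hHi] with t ht
    rw [timeWeight, ht]
    by_cases hm : t ∈ Set.Ioc 0 T
    · rw [Set.indicator_of_mem hm, Set.indicator_of_mem hm, div_mul_eq_mul_div (2 ^ s : ℝ) b,
        le_div_iff₀' hbpos]
      exact norm_timeWeight_le H hm.1.le
    · simp [Set.indicator_of_notMem hm]
  have hφle : eLpNorm (weighted α s k φ) 2 (volume.restrict (Set.Ioc 0 T)) ≤
      ENNReal.ofReal b * eLpNorm (timeWeight μ s φt) 2 volume := by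
    rw [← eLpNorm_indicator_eq_eLpNorm_restrict measurableSet_Ioc]
    refine eLpNorm_le_mul_eLpNorm_of_ae_le_mul (Eventually.of_forall fun t => ?_) 2
    by_cases hm : t ∈ Set.Ioc 0 T
    · rw [Set.indicator_of_mem hm, timeWeight, hφt, Set.indicator_of_mem (by exact hm.1)]
      exact norm_weighted_le φ hm.1.le
    · rw [Set.indicator_of_notMem hm, norm_zero]
      positivity
  have hφm : AEStronglyMeasurable φt := aestronglyMeasurable_indicator_Ioi hφ.locallyIntegrable
  have hHfin : eLpNorm (timeWeight μ s Ht) 2 volume < ∞ :=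
    hHle.trans_lt (ENNReal.mul_lt_top ENNReal.ofReal_lt_top hH.2)
  have heq := hφ.equation
  rw [ae_restrict_iff' measurableSet_Ioi] at heq
  have main := hC μ K Ht φt hμ0 (aestronglyMeasurable_causalKernel hst.aestronglyMeasurable) hK0 hKA
    (le_norm_one_sub_fourier_damp hst) hHm hHfin (hcausal _) hφm
    (integrableOn_Iic_indicator hφ.locallyIntegrable) (hcausal _) (by
      filter_upwards [heq] with t ht
      rcases le_or_gt t 0 with h | h
      · rw [hφt, hHt, hcausal _ t h, hcausal _ t h,
          convolution_eq_zero_of_nonpos hK0 (hcausal _) h, add_zero]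
      · rw [hK, hφt, convolution_causalKernel _ h, hHt, Set.indicator_of_mem (by exact h),
          Set.indicator_of_mem (by exact h)]
        exact ht h)
  have hfin : eLpNorm (weighted α s k φ) 2 (volume.restrict (Set.Ioc 0 T)) ≤
      ENNReal.ofReal (2 ^ s * C + 1) *
        eLpNorm (weighted α s k H) 2 (volume.restrict (Set.Ioc 0 T)) := by
    calc _ ≤ ENNReal.ofReal b * (C * (ENNReal.ofReal (2 ^ s / b) *
          eLpNorm (weighted α s k H) 2 (volume.restrict (Set.Ioc 0 T)))) :=
          hφle.trans (mul_le_mul' le_rfl (main.trans (mul_le_mul' le_rfl hHle)))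
      _ = ENNReal.ofReal (2 ^ s * C) *
          eLpNorm (weighted α s k H) 2 (volume.restrict (Set.Ioc 0 T)) := by
          rw [← ENNReal.ofReal_coe_nnreal, ← mul_assoc, ← mul_assoc, ← ENNReal.ofReal_mul hb0,
            ← ENNReal.ofReal_mul (by positivity)]
          congr 2
          field_simp
      _ ≤ _ := by gcongr; linarith
  refine ⟨⟨?_, hfin.trans_lt (ENNReal.mul_lt_top ENNReal.ofReal_lt_top hH.2)⟩, hfin⟩
  have hcw : Continuous fun t : ℝ =>
      ((‖k‖ ^ α * √(1 + ‖k‖ ^ 2 + ‖t • k‖ ^ 2) ^ s : ℝ) : ℂ) := by fun_prop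
  exact hcw.aestronglyMeasurable.mul (hφ.locallyIntegrable T).1
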